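/- Let $\mathbb S^2\subset\mathbb R^3$ be the unit sphere with its surface measure (total mass $4\pi$), let $P_\ell$ be the Legendre polynomial of degree $\ell$ with $P_\ell(1)=1$, and for each $\ell\ge 0$ let $(Y_{\ell,k})_{k=1}^{2\ell+1}$ be an $L_2(\mathbb S^2)$-orthonormal basis of the real spherical harmonics of degree $\ell$. For $\ell\ge1$ put $$\mathbf y_{\ell,k}=\frac{\mathbf L_*Y_{\ell,k}}{\sqrt{\ell(\ell+1)}},\qquad \mathbf z_{\ell,k}=\frac{\nabla_*Y_{\ell,k}}{\sqrt{\ell(\ell+1)}},$$ where $\nabla_*$ is the surface gradient and $\mathbf L_*f(x)=x\times\nabla_*f(x)$ is the surface curl. Let $\psi:[-1,1]\to\mathbb R$ be continuous, and set $$\widehat\psi(\ell)=2\pi\int_{-1}^1\psi(t)P_\ell(t)\,\mathrm dt .$$ Suppose that $\widehat\psi(0)=1$ and $\sum_{\ell\ge1}\ell\,|\widehat\psi(\ell)|<\infty$. Then: (i) The function $$\kappa(t)=\frac1{4\pi(1-t^2)}\int_{-1}^t\bigl(1-4\pi\psi(s)\bigr)\,\mathrm ds,\qquad -1<t<1,$$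 is differentiable on $(-1,1)$ and extends continuously to $[-1,1]$; the extension is again denoted by $\kappa$. (ii) For $x,y\in\mathbb S^2$ let $t=x\cdot y$ and $$\mathbf Q=-(x\times y)(x\times y)^\top,\quad \mathbf R=t\mathbf I-yx^\top,\quad \mathbf V=(y-tx)(x-ty)^\top,\quad \mathbf W=(\mathbf I-xx^\top)(\mathbf I-yy^\top).$$ The matrix-valued kernels $$\Psi^{\mathrm{div}}(x,y)=\kappa'(t)\mathbf Q+\kappa(t)\mathbf R,\qquad \Psi^{\mathrm{curl}}(x,y)=\kappa'(t)\mathbf V+\kappa(t)\mathbf W,$$ defined for $x\ne\pm y$, extend to continuous functions on $\mathbb S^2\times\mathbb S^2$, with the values $\kappa(t)\mathbf R$ and $\kappa(t)\mathbf W$, respectively, at $x=\pm y$. (iii) For these extensions and for all $x,y\in\mathbb S^2$, $$\Psi^{\mathrm{div}}(x,y)=\sum_{\ell=1}^\infty\widehat\psi(\ell)\sum_{k=1}^{2\ell+1}\mathbf y_{\ell,k}(x)\,\mathbf y_{\ell,k}(y)^\top,\qquad \Psi^{\mathrm{curl}}(x,y)=\sum_{\ell=1}^\infty\widehat\psi(\ell)\sum_{k=1}^{2\ell+1}\mathbf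 z_{\ell,k}(x)\,\mathbf z_{\ell,k}(y)^\top,$$ and both series over $\ell$ converge absolutely and uniformly on $\mathbb S^2\times\mathbb S^2$: the series of spectral norms of their terms, as well as the series themselves, converge uniformly on $\mathbb S^2\times\mathbb S^2$. -/

import Mathlib

open Filter Topology MeasureTheory
open scoped Matrix Matrix.Norms.L2Operator

/-! Norms of matrices are spectral norms (operator norms for the Euclidean vector norm). -/

namespace SphereKernel

noncomputable section

/-- Euclidean three-space. -/
abbrev E3 : Type := EuclideanSpace ℝ (Fin 3)

/-- The unit sphere of Euclidean three-space. -/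
abbrev S2 : Type := Metric.sphere (0 : E3) 1

/-- Real three-by-three matrices. -/
abbrev Mat3 : Type := Matrix (Fin 3) (Fin 3) ℝ

/-- The coordinate vector of a point of the sphere. -/
def vec (x : S2) : Fin 3 → ℝ := (x : E3).ofLp

/-- The surface measure of the sphere, of total mass `4π`. -/
def surfaceMeasure : Measure S2 := (volume : Measure E3).toSphere

/-! ### Legendre polynomials and Fourier-Legendre coefficients -/

/-- The Legendre polynomial of degree `ℓ`, by the Rodrigues formula; its value at `1` is `1`. -/
def legendreP (ℓ : ℕ) : Polynomial ℝ :=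
  Polynomial.C ((2 ^ ℓ * (ℓ.factorial : ℝ))⁻¹) *
    (Polynomial.derivative^[ℓ]) ((Polynomial.X ^ 2 - 1) ^ ℓ)

/-- The coefficients `a ℓ` in the expansion `ψ(t) = ∑ (2ℓ+1)/(4π) * a ℓ * P_ℓ(t)`. -/
def fourierLegendreCoeff (ψ : ℝ → ℝ) (ℓ : ℕ) : ℝ :=
  2 * Real.pi * ∫ t in (-1 : ℝ)..1, ψ t * (legendreP ℓ).eval t

/-! ### Scalar spherical harmonics -/

/-- `f` is a real spherical harmonic of degree `ℓ`: the restriction to the sphere of a harmonic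
homogeneous polynomial of degree `ℓ`. -/
def IsSphericalHarmonic (ℓ : ℕ) (f : S2 → ℝ) : Prop :=
  ∃ p : MvPolynomial (Fin 3) ℝ, p.IsHomogeneous ℓ ∧
    ∑ i, MvPolynomial.pderiv i (MvPolynomial.pderiv i p) = 0 ∧
    ∀ x, f x = MvPolynomial.eval (vec x) p

/-- `Y` is an orthonormal basis, for the inner product of `L²` of the sphere, of the space of
spherical harmonics of degree `ℓ`. -/
structure IsHarmonicOrthonormalBasis (ℓ : ℕ) (Y : Fin (2 * ℓ + 1) → S2 → ℝ) : Prop where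
  harmonic : ∀ k, IsSphericalHarmonic ℓ (Y k)
  orthonormal : ∀ j k, ∫ x, Y j x * Y k x ∂surfaceMeasure = if j = k then 1 else 0
  spanning : ∀ f, IsSphericalHarmonic ℓ f → f ∈ Submodule.span ℝ (Set.range Y)

/-! ### Surface gradient, surface curl, vector spherical harmonics -/

/-- The extension of `f` that is constant on rays, `z ↦ f(z/|z|)`; the value at `0` is
irrelevant. -/
def radialExtension (f : S2 → ℝ) (z : E3) : ℝ :=
  if h : z = 0 then 0 else
    f ⟨‖z‖⁻¹ • z, by simp [norm_smul, h]⟩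

/-- The surface gradient `∇_* f`. -/
def surfaceGradient (f : S2 → ℝ) (x : S2) : Fin 3 → ℝ :=
  (gradient (radialExtension f) (x : E3)).ofLp

/-- The surface curl `L_* f = x × ∇f`. -/
def surfaceCurl (f : S2 → ℝ) (x : S2) : Fin 3 → ℝ :=
  vec x ⨯₃ surfaceGradient f x

/-- `L_* Y / √(ℓ(ℓ+1))`, used for `ℓ ≥ 1`. -/
def divHarmonic (ℓ : ℕ) (Y : S2 → ℝ) (x : S2) : Fin 3 → ℝ :=
  (√((ℓ : ℝ) * (ℓ + 1)))⁻¹ • surfaceCurl Y x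

/-- `∇_* Y / √(ℓ(ℓ+1))`, used for `ℓ ≥ 1`. -/
def curlHarmonic (ℓ : ℕ) (Y : S2 → ℝ) (x : S2) : Fin 3 → ℝ :=
  (√((ℓ : ℝ) * (ℓ + 1)))⁻¹ • surfaceGradient Y x

/-! ### The auxiliary function and the kernels -/

/-- The quotient defining the auxiliary function, for `-1 < t < 1`. -/
def kappaQuotient (ψ : ℝ → ℝ) (t : ℝ) : ℝ :=
  (1 / (4 * Real.pi * (1 - t ^ 2))) * ∫ s in (-1 : ℝ)..t, (1 - 4 * Real.pi * ψ s)

/-- The auxiliary function on `[-1,1]`: the values at `-1` and `1` are the limits of the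
quotient from inside the interval. -/
def kappa (ψ : ℝ → ℝ) : ℝ → ℝ :=
  extendFrom (Set.Ioo (-1) 1) (kappaQuotient ψ)

/-- The inner product `t = x · y`. -/
def dotp (x y : S2) : ℝ := inner ℝ (x : E3) (y : E3)

/-- `Q = -(x × y)(x × y)ᵀ` -/
def matQ (x y : S2) : Mat3 :=
  -Matrix.vecMulVec (vec x ⨯₃ vec y) (vec x ⨯₃ vec y)

/-- `R = t I - y xᵀ` -/
def matR (x y : S2) : Mat3 :=
  dotp x y • (1 : Mat3) - Matrix.vecMulVec (vec y) (vec x)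

/-- `V = (y - t x)(x - t y)ᵀ` -/
def matV (x y : S2) : Mat3 :=
  Matrix.vecMulVec (vec y - dotp x y • vec x) (vec x - dotp x y • vec y)

/-- `W = (I - x xᵀ)(I - y yᵀ)` -/
def matW (x y : S2) : Mat3 :=
  (1 - Matrix.vecMulVec (vec x) (vec x)) * (1 - Matrix.vecMulVec (vec y) (vec y))

/-- `κ'(t) Q + κ(t) R`, meaningful for `x ≠ ±y`, where `-1 < t < 1`. -/
def kernelDiv (ψ : ℝ → ℝ) (x y : S2) : Mat3 :=
  deriv (kappa ψ) (dotp x y) • matQ x y + kappa ψ (dotp x y) • matR x y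

/-- `κ'(t) V + κ(t) W`, meaningful for `x ≠ ±y`, where `-1 < t < 1`. -/
def kernelCurl (ψ : ℝ → ℝ) (x y : S2) : Mat3 :=
  deriv (kappa ψ) (dotp x y) • matV x y + kappa ψ (dotp x y) • matW x y

/-! ### The expansions -/

/-- `ψ̂(ℓ) ∑_k y_{ℓ,k}(x) y_{ℓ,k}(y)ᵀ` -/
def divTerm (ψ : ℝ → ℝ) (Y : (ℓ : ℕ) → Fin (2 * ℓ + 1) → S2 → ℝ) (ℓ : ℕ) (p : S2 × S2) : Mat3 :=
  fourierLegendreCoeff ψ ℓ •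
    ∑ k, Matrix.vecMulVec (divHarmonic ℓ (Y ℓ k) p.1) (divHarmonic ℓ (Y ℓ k) p.2)

/-- `ψ̂(ℓ) ∑_k z_{ℓ,k}(x) z_{ℓ,k}(y)ᵀ` -/
def curlTerm (ψ : ℝ → ℝ) (Y : (ℓ : ℕ) → Fin (2 * ℓ + 1) → S2 → ℝ) (ℓ : ℕ) (p : S2 × S2) : Mat3 :=
  fourierLegendreCoeff ψ ℓ •
    ∑ k, Matrix.vecMulVec (curlHarmonic ℓ (Y ℓ k) p.1) (curlHarmonic ℓ (Y ℓ k) p.2)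

/-- The series `∑_{ℓ ≥ 1} u ℓ` has the sum `s` on the whole of `X`, and it converges absolutely
and uniformly there: at each point the norms are summable, and both the series of norms and
the series itself converge uniformly on `X`. -/
def SumsAbsolutelyUniformlyTo {X : Type*} (u : ℕ → X → Mat3) (s : X → Mat3) : Prop :=
  (∀ p, Summable fun n : ℕ => ‖u (n + 1) p‖) ∧
  TendstoUniformly (fun (N : ℕ) p => ∑ ℓ ∈ Finset.Icc 1 N, ‖u ℓ p‖)
    (fun p => ∑' n : ℕ, ‖u (n + 1) p‖) atTop ∧
  TendstoUniformly (fun (N : ℕ) p => ∑ ℓ ∈ Finset.Icc 1 N, u ℓ p) s atTop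

end

end SphereKernel

open SphereKernel

/-! Both kernels are identified with their series through expansions in derivatives of Legendre
polynomials.

Analytic side. The summability hypothesis gives `ψ = ∑ (2ℓ+1)/(4π) ψ̂(ℓ) P_ℓ` uniformly on `[-1,1]`
(`hasSum_fourierLegendre`, by orthogonality and Weierstrass approximation). The Legendre equation
`((1-t²)P_ℓ')' = -ℓ(ℓ+1)P_ℓ` integrates each `P_ℓ` with `ℓ ≥ 1`, and `ψ̂(0) = 1` cancels the
constant term of `1 - 4πψ`. Hence `κ = ∑ c_ℓ P_ℓ'` with `c_ℓ = (2ℓ+1)/(4πℓ(ℓ+1)) ψ̂(ℓ)`. Since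
`|P_ℓ'| ≤ ℓ(ℓ+1)/2` and `∑ ℓ(ℓ+1)|c_ℓ| < ∞`, this series is continuous up to the endpoints. Inside
the interval `κ' = ∑ c_ℓ P_ℓ''` follows algebraically from the series for `κ` and `ψ`.

Geometric side. The kernel `∑_k Y_k(x)Y_k(y)` is invariant under isometries, so with one point at
the pole it is a zonal harmonic; such a function solves the Legendre equation and is a multiple of
`P_ℓ(x·y)`, with the factor fixed by integrating over the diagonal (`sum_harmonics_eq_legendreP`).
Differentiating in both variables turns the terms of the two series into `c_ℓ(P_ℓ'' V + P_ℓ' W)` and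
`c_ℓ(P_ℓ'' Q + P_ℓ' R)`.

The entries of `V` and `Q` are at most `1 - t²` in absolute value, and `(1-t²)|P_ℓ''| ≤ 2ℓ(ℓ+1)`.
The Weierstrass test therefore applies on the whole of `S2 × S2`, the diagonal and antidiagonal
included, and the sum of the series is itself the continuous extension (`exists_kernel_expansion`).
-/

namespace SphereKernel

/-! ### Legendre polynomials: differential equation, endpoint values, uniqueness. -/

open Polynomial in
theorem rodrigues_base (ℓ : ℕ) :
    (X ^ 2 - 1 : ℝ[X]) * derivative ((X ^ 2 - 1) ^ ℓ) = 2 * (ℓ : ℝ[X]) * X * (X ^ 2 - 1) ^ ℓ := by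
  cases ℓ with
  | zero => simp
  | succ n =>
    rw [derivative_pow]
    simp only [Nat.add_sub_cancel, derivative_sub, derivative_X_pow, derivative_one]
    simp only [Nat.cast_ofNat, Nat.cast_add, Nat.cast_one, pow_succ]
    simp only [map_add, map_one, map_natCast, map_ofNat]
    simp
    ring

open Polynomial in
-- This is `rodrigues_base` differentiated `n + 1` times. At `n = ℓ` the coefficients become `2` and
-- `ℓ(ℓ+1)`, which is the Legendre equation.
theorem rodrigues_iterate (ℓ n : ℕ) :
    (X ^ 2 - 1 : ℝ[X]) * derivative^[n + 2] ((X ^ 2 - 1) ^ ℓ)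
      + 2 * ((n : ℝ[X]) + 1 - (ℓ : ℝ[X])) * X * derivative^[n + 1] ((X ^ 2 - 1) ^ ℓ)
      = ((n : ℝ[X]) + 1) * (2 * (ℓ : ℝ[X]) - (n : ℝ[X])) * derivative^[n] ((X ^ 2 - 1) ^ ℓ) := by
  induction n with
  | zero =>
    have h := congrArg derivative (rodrigues_base ℓ)
    simp only [derivative_mul, derivative_sub, derivative_X_pow, derivative_one, derivative_X,
      derivative_natCast, derivative_ofNat] at h
    simp only [Function.iterate_succ_apply', Function.iterate_zero, id]
    simp only [Nat.cast_zero, Nat.cast_ofNat] at h ⊢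
    simp at h ⊢
    rw [show (C 2 : ℝ[X]) = 2 from map_ofNat C 2] at h
    linear_combination h
  | succ n ih =>
    have h := congrArg derivative ih
    simp only [Function.iterate_succ_apply', derivative_mul, derivative_add, derivative_sub,
      derivative_X_pow, derivative_one, derivative_X, derivative_natCast, derivative_ofNat] at h ⊢
    simp only [Nat.cast_succ] at h ⊢
    simp at h ⊢
    linear_combination h

open Polynomial in
/-- The Legendre differential equation. -/
theorem legendreP_ode (ℓ : ℕ) :
    (X ^ 2 - 1) * derivative (derivative (legendreP ℓ)) + 2 * X * derivative (legendreP ℓ)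
      = (ℓ : ℝ[X]) * ((ℓ : ℝ[X]) + 1) * legendreP ℓ := by
  have h := rodrigues_iterate ℓ ℓ
  simp only [Function.iterate_succ_apply'] at h
  simp only [legendreP, derivative_C_mul]
  linear_combination (C (2 ^ ℓ * (ℓ.factorial : ℝ))⁻¹) * h

open Polynomial in
-- In `(X²-1)^ℓ = (X-1)^ℓ (X+1)^ℓ` the `ℓ` derivatives must all fall on the factor vanishing at `1`,
-- which leaves `ℓ! 2^ℓ`.
theorem legendreP_eval_one (ℓ : ℕ) : (legendreP ℓ).eval 1 = 1 := by
  have h := aeval_iterate_derivative_self (A := ℝ) ((X ^ 2 - 1 : ℝ[X]) ^ ℓ) ℓ 1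
    (p' := (X + 1) ^ ℓ) (by simp [← mul_pow]; ring)
  simp only [coe_aeval_eq_eval, eval_pow, eval_add, eval_X, eval_one, nsmul_eq_mul] at h
  rw [legendreP, eval_mul, eval_C, h]
  have : (ℓ.factorial : ℝ) ≠ 0 := by positivity
  field_simp
  norm_num

open Polynomial in
theorem legendreP_eval_neg_one (ℓ : ℕ) : (legendreP ℓ).eval (-1) = (-1) ^ ℓ := by
  have h := aeval_iterate_derivative_self (A := ℝ) ((X ^ 2 - 1 : ℝ[X]) ^ ℓ) ℓ (-1)
    (p' := (X - 1) ^ ℓ) (by simp [← mul_pow]; ring)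
  simp only [coe_aeval_eq_eval, eval_pow, eval_sub, eval_X, eval_one, nsmul_eq_mul] at h
  rw [legendreP, eval_mul, eval_C, h]
  have : (ℓ.factorial : ℝ) ≠ 0 := by positivity
  rw [show (-1 - 1 : ℝ) = -1 * 2 by norm_num, mul_pow]
  field_simp

theorem legendreP_ne_zero (ℓ : ℕ) : legendreP ℓ ≠ 0 := fun h => by
  have := legendreP_eval_one ℓ
  simp [h] at this

/-- A nonzero polynomial solution of the Legendre equation has degree `ℓ`. -/
theorem natDegree_of_legendre_ode {ℓ : ℕ} {g : Polynomial ℝ} (hg : g ≠ 0)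
    (h : (Polynomial.X ^ 2 - 1) * g.derivative.derivative + 2 * Polynomial.X * g.derivative
      = (ℓ : Polynomial ℝ) * ((ℓ : Polynomial ℝ) + 1) * g) : g.natDegree = ℓ := by
  set d := g.natDegree with hd
  -- Compare coefficients of `X^d`: on the left the leading coefficient is multiplied by `d(d-1) +
  -- 2d`. On natural numbers `d(d+1)` determines `d`.
  have key : ((d : ℝ) * (d + 1)) * g.coeff d = ((ℓ : ℝ) * (ℓ + 1)) * g.coeff d := by
    have hc := congrArg (fun q => Polynomial.coeff q d) h
    have e1 : ((ℓ : Polynomial ℝ) * ((ℓ : Polynomial ℝ) + 1) * g).coeff d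
        = ((ℓ : ℝ) * (ℓ + 1)) * g.coeff d := by
      rw [← Polynomial.coeff_C_mul]; simp
    have hz : g.coeff (d + 2) = 0 := Polynomial.coeff_eq_zero_of_natDegree_lt (by omega)
    have e2 : (2 * Polynomial.X * g.derivative).coeff d = 2 * d * g.coeff d := by
      rw [mul_assoc, show (2 : Polynomial ℝ) = Polynomial.C 2 from (map_ofNat Polynomial.C 2).symm,
        Polynomial.coeff_C_mul]
      rcases d with _ | d
      · simp
      · rw [Polynomial.coeff_X_mul, Polynomial.coeff_derivative]; push_cast; ring
    have e3 : ((Polynomial.X ^ 2 - 1) * g.derivative.derivative).coeff d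
        = d * (d - 1) * g.coeff d := by
      rw [sub_mul, one_mul, Polynomial.coeff_sub]
      simp only [Polynomial.coeff_derivative, hz, Polynomial.coeff_X_pow_mul']
      rcases d with _ | _ | d
      · simp
      · simp
      · simp; ring
    simp only [Polynomial.coeff_add, e1, e2, e3] at hc
    linarith
  have hl : g.coeff d ≠ 0 := by simpa [hd] using hg
  have h2 : (d : ℝ) * (d + 1) = (ℓ : ℝ) * (ℓ + 1) := mul_right_cancel₀ hl key
  have h3 : ((d : ℝ) - ℓ) * (d + ℓ + 1) = 0 := by linarith
  rcases mul_eq_zero.1 h3 with h4 | h4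
  · exact_mod_cast sub_eq_zero.1 h4
  · have : (0 : ℝ) < d + ℓ + 1 := by positivity
    linarith

theorem natDegree_legendreP (ℓ : ℕ) : (legendreP ℓ).natDegree = ℓ :=
  natDegree_of_legendre_ode (legendreP_ne_zero ℓ) (legendreP_ode ℓ)

/-- Polynomial solutions of the Legendre equation are multiples of the Legendre polynomial. -/
theorem eq_smul_legendreP_of_ode {ℓ : ℕ} {g : Polynomial ℝ}
    (h : (Polynomial.X ^ 2 - 1) * g.derivative.derivative + 2 * Polynomial.X * g.derivative
      = (ℓ : Polynomial ℝ) * ((ℓ : Polynomial ℝ) + 1) * g) :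
    g = Polynomial.C (g.eval 1) * legendreP ℓ := by
  have hl := legendreP_ode ℓ
  have hlc : (legendreP ℓ).coeff ℓ ≠ 0 := by
    have := legendreP_ne_zero ℓ
    rw [← Polynomial.leadingCoeff_ne_zero, Polynomial.leadingCoeff, natDegree_legendreP] at this
    exact this
  have hex : ∃ c : ℝ, g = Polynomial.C c * legendreP ℓ := by
    -- This multiple cancels the coefficient of `X^ℓ`. The difference still solves the equation, so
    -- if nonzero it would have degree `ℓ`, a contradiction.
    refine ⟨g.coeff ℓ / (legendreP ℓ).coeff ℓ, ?_⟩
    set c := g.coeff ℓ / (legendreP ℓ).coeff ℓ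
    by_contra hne
    have hne' : g - Polynomial.C c * legendreP ℓ ≠ 0 := sub_ne_zero.2 hne
    have hdeg := natDegree_of_legendre_ode (ℓ := ℓ) hne' (by
      simp only [Polynomial.derivative_sub, Polynomial.derivative_C_mul]
      linear_combination h - Polynomial.C c * hl)
    have := Polynomial.leadingCoeff_ne_zero.2 hne'
    rw [Polynomial.leadingCoeff, hdeg, Polynomial.coeff_sub, Polynomial.coeff_C_mul] at this
    apply this
    simp only [c]
    field_simp
    simp
  obtain ⟨c, hc⟩ := hex
  have : g.eval 1 = c := by rw [hc]; simp [legendreP_eval_one]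
  rw [this, hc]

/-! ### Bounds on `[-1,1]` -/

/-- Sonine's monotonicity argument for polynomial solutions of Gegenbauer's equation. -/
theorem sq_add_le_of_gegenbauer_ode {y : Polynomial ℝ} {a μ M : ℝ} (ha : 1 / 2 ≤ a) (hμ : 0 < μ)
    (h : ∀ t : ℝ, (1 - t ^ 2) * y.derivative.derivative.eval t - 2 * a * t * y.derivative.eval t
      + μ * y.eval t = 0)
    (h1 : (y.eval 1) ^ 2 = M) (h2 : (y.eval (-1)) ^ 2 = M) {t : ℝ} (ht : t ∈ Set.Icc (-1 : ℝ) 1) :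
    (y.eval t) ^ 2 + (1 - t ^ 2) * (y.derivative.eval t) ^ 2 / μ ≤ M := by
  -- The equation eliminates `y''` from `F'` and leaves `2(2a-1) t y'²/μ`. This has the sign of `t`,
  -- so `F` is largest at the endpoints, where it equals `M`.
  set F : ℝ → ℝ := fun t => (y.eval t) ^ 2 + (1 - t ^ 2) * (y.derivative.eval t) ^ 2 / μ with hF
  have hd : ∀ t, HasDerivAt F (2 * (2 * a - 1) * t * (y.derivative.eval t) ^ 2 / μ) t := by
    intro t
    have e1 := (y.hasDerivAt t).pow 2
    have e2 := (((hasDerivAt_id t).pow 2).const_sub 1).mul ((y.derivative.hasDerivAt t).pow 2)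
    have e3 := e1.add (e2.div_const μ)
    refine (e3.congr_deriv ?_)
    simp
    field_simp
    linear_combination (y.derivative.eval t) * h t
  have hcont : Continuous F := continuous_iff_continuousAt.2 fun t => (hd t).continuousAt
  have hdiff : Differentiable ℝ F := fun t => (hd t).differentiableAt
  rcases le_total 0 t with h0 | h0
  · have hm : MonotoneOn F (Set.Icc 0 1) := by
      apply monotoneOn_of_deriv_nonneg (convex_Icc 0 1) hcont.continuousOn hdiff.differentiableOn
      intro s hs
      rw [interior_Icc] at hs
      rw [(hd s).deriv]
      have := hs.1
      have : 0 ≤ 2 * a - 1 := by linarith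
      positivity
    have := hm ⟨h0, ht.2⟩ ⟨zero_le_one, le_rfl⟩ ht.2
    simpa [hF, h1] using this
  · have hm : AntitoneOn F (Set.Icc (-1) 0) := by
      apply antitoneOn_of_deriv_nonpos (convex_Icc (-1) 0) hcont.continuousOn
        hdiff.differentiableOn
      intro s hs
      rw [interior_Icc] at hs
      rw [(hd s).deriv]
      have h3 := hs.2
      have h4 : 0 ≤ 2 * a - 1 := by linarith
      apply div_nonpos_of_nonpos_of_nonneg _ hμ.le
      nlinarith [mul_nonneg h4 (sq_nonneg (y.derivative.eval s))]
    have := hm ⟨le_rfl, by norm_num⟩ ⟨ht.1, h0⟩ ht.1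
    simpa [hF, h2] using this

theorem legendreP_ode_eval (ℓ : ℕ) (t : ℝ) :
    (1 - t ^ 2) * (legendreP ℓ).derivative.derivative.eval t
      - 2 * t * (legendreP ℓ).derivative.eval t + (ℓ * (ℓ + 1)) * (legendreP ℓ).eval t = 0 := by
  have h := congrArg (Polynomial.eval t) (legendreP_ode ℓ)
  simp at h
  linarith

theorem legendreP_zero : legendreP 0 = 1 := by simp [legendreP]

theorem abs_legendreP_le_one (ℓ : ℕ) {t : ℝ} (ht : t ∈ Set.Icc (-1 : ℝ) 1) :
    |(legendreP ℓ).eval t| ≤ 1 := by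
  rcases Nat.eq_zero_or_pos ℓ with rfl | hℓ
  · simp [legendreP_zero]
  have hμ : (0 : ℝ) < ℓ * (ℓ + 1) := by positivity
  have h := sq_add_le_of_gegenbauer_ode (y := legendreP ℓ) (a := 1) (M := 1) (by norm_num) hμ
    (fun t => by linarith [legendreP_ode_eval ℓ t]) (by simp [legendreP_eval_one])
    (by rw [legendreP_eval_neg_one, ← pow_mul, mul_comm, pow_mul]; simp) ht
  have h1 : 0 ≤ (1 - t ^ 2) * ((legendreP ℓ).derivative.eval t) ^ 2 / (ℓ * (ℓ + 1)) := by
    have : 0 ≤ 1 - t ^ 2 := by nlinarith [ht.1, ht.2]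
    positivity
  rw [← sq_le_one_iff_abs_le_one]
  linarith

/-- The differentiated Legendre equation is Gegenbauer's with `a = 2` and `μ = ℓ(ℓ+1) - 2`. The
endpoint values of `P_ℓ'` come from the Legendre equation at `±1`. -/
theorem abs_derivative_legendreP_le (ℓ : ℕ) {t : ℝ} (ht : t ∈ Set.Icc (-1 : ℝ) 1) :
    |(legendreP ℓ).derivative.eval t| ≤ ℓ * (ℓ + 1) / 2 := by
  have e1 : (legendreP ℓ).derivative.eval 1 = ℓ * (ℓ + 1) / 2 := by
    have := legendreP_ode_eval ℓ 1
    rw [legendreP_eval_one] at this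
    linarith
  have e2 : ((legendreP ℓ).derivative.eval (-1)) ^ 2 = (ℓ * (ℓ + 1) / 2) ^ 2 := by
    have := legendreP_ode_eval ℓ (-1)
    rw [legendreP_eval_neg_one] at this
    have h3 : (legendreP ℓ).derivative.eval (-1) = -((ℓ * (ℓ + 1) / 2) * (-1) ^ ℓ) := by linarith
    rw [h3, neg_sq, mul_pow, ← pow_mul, mul_comm ℓ 2, pow_mul]
    simp
  refine abs_le_of_sq_le_sq ?_ (by positivity)
  -- For `ℓ < 2` the parameter `μ` is not positive, but then `P_ℓ'` is constant.
  rcases lt_or_ge ℓ 2 with hℓ | hℓ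
  · have hdeg : (legendreP ℓ).derivative.natDegree = 0 := by
      have := Polynomial.natDegree_derivative_le (legendreP ℓ)
      rw [natDegree_legendreP] at this
      omega
    rw [Polynomial.eq_C_of_natDegree_eq_zero hdeg] at e1 ⊢
    simp only [Polynomial.eval_C] at e1 ⊢
    rw [e1]
  · have hℓ' : (2 : ℝ) ≤ ℓ := by exact_mod_cast hℓ
    have hμ : (0 : ℝ) < ℓ * (ℓ + 1) - 2 := by nlinarith
    have h := sq_add_le_of_gegenbauer_ode (y := (legendreP ℓ).derivative) (a := 2)
      (M := (ℓ * (ℓ + 1) / 2) ^ 2) (by norm_num) hμ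
      (fun t => by
        have h := congrArg (fun q => Polynomial.eval t (Polynomial.derivative q)) (legendreP_ode ℓ)
        simp at h
        linarith) (by rw [e1]) e2 ht
    have h1 : 0 ≤ (1 - t ^ 2) * ((legendreP ℓ).derivative.derivative.eval t) ^ 2
        / (ℓ * (ℓ + 1) - 2) := by
      have : 0 ≤ 1 - t ^ 2 := by nlinarith [ht.1, ht.2]
      positivity
    linarith

/-- Solve the Legendre equation for `(1-t²)P_ℓ'' = 2tP_ℓ' - ℓ(ℓ+1)P_ℓ`. Each of the two terms is at
most `ℓ(ℓ+1)` in absolute value. -/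
theorem abs_one_sub_sq_mul_derivative_two_legendreP_le (ℓ : ℕ) {t : ℝ}
    (ht : t ∈ Set.Icc (-1 : ℝ) 1) :
    |(1 - t ^ 2) * (legendreP ℓ).derivative.derivative.eval t| ≤ 2 * ((ℓ : ℝ) * ((ℓ : ℝ) + 1)) := by
  have h := legendreP_ode_eval ℓ t
  have h1 := abs_le.1 (abs_legendreP_le_one ℓ ht)
  have h2 := abs_le.1 (abs_derivative_legendreP_le ℓ ht)
  have hl : (0 : ℝ) ≤ ℓ * (ℓ + 1) := by positivity
  have h3 : |t * (legendreP ℓ).derivative.eval t| ≤ 1 * ((ℓ : ℝ) * ((ℓ : ℝ) + 1) / 2) := by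
    rw [abs_mul]
    exact mul_le_mul (abs_le.2 ht) (abs_derivative_legendreP_le ℓ ht) (abs_nonneg _) zero_le_one
  have h4 := abs_le.1 h3
  rw [abs_le]
  constructor <;> nlinarith

/-! ### Orthogonality -/

/-- Integration by parts; the boundary terms vanish with `X² - 1`. The right side is symmetric in
`p` and `q`, so eigenfunctions with distinct eigenvalues are orthogonal. -/
theorem integral_one_sub_sq_mul_deriv (p q : Polynomial ℝ) :
    ∫ t in (-1 : ℝ)..1, (((Polynomial.X ^ 2 - 1) * p.derivative.derivative
      + 2 * Polynomial.X * p.derivative) * q).eval t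
      = - ∫ t in (-1 : ℝ)..1, ((Polynomial.X ^ 2 - 1) * p.derivative * q.derivative).eval t := by
  have h := intervalIntegral.integral_eq_sub_of_hasDerivAt (a := -1) (b := 1)
    (f := fun t => ((Polynomial.X ^ 2 - 1) * p.derivative * q).eval t)
    (f' := fun t => ((Polynomial.X ^ 2 - 1) * p.derivative * q).derivative.eval t)
    (fun t _ => Polynomial.hasDerivAt _ t) ((Polynomial.continuous _).intervalIntegrable _ _)
  rw [eq_neg_iff_add_eq_zero, ← intervalIntegral.integral_add
    ((Polynomial.continuous _).intervalIntegrable _ _)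
    ((Polynomial.continuous _).intervalIntegrable _ _)]
  have h0 : ∫ t in (-1 : ℝ)..1, ((Polynomial.X ^ 2 - 1) * p.derivative * q).derivative.eval t
      = 0 := by
    rw [h]; simp
  rw [← h0]
  congr 1
  ext t
  simp only [Polynomial.derivative_mul, Polynomial.derivative_sub, Polynomial.derivative_X_pow,
    Polynomial.derivative_one, Polynomial.eval_add, Polynomial.eval_mul, Polynomial.eval_sub,
    Polynomial.eval_pow, Polynomial.eval_X, Polynomial.eval_one, Polynomial.eval_ofNat,
    Polynomial.eval_C, Polynomial.eval_zero, Nat.cast_ofNat]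
  ring

theorem integral_legendreP_mul_of_ne {m n : ℕ} (hmn : m ≠ n) :
    ∫ t in (-1 : ℝ)..1, (legendreP m).eval t * (legendreP n).eval t = 0 := by
  have h1 := integral_one_sub_sq_mul_deriv (legendreP m) (legendreP n)
  have h2 := integral_one_sub_sq_mul_deriv (legendreP n) (legendreP m)
  rw [legendreP_ode] at h1 h2
  simp only [Polynomial.eval_mul, mul_assoc] at h1 h2
  simp only [← mul_assoc, Polynomial.eval_natCast, Polynomial.eval_add, Polynomial.eval_one] at h1 h2
  simp only [mul_assoc, intervalIntegral.integral_const_mul] at h1 h2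
  have e1 : ∀ t : ℝ, (legendreP n).eval t * (legendreP m).eval t
      = (legendreP m).eval t * (legendreP n).eval t := fun t => mul_comm _ _
  have e2 : ∀ t : ℝ, (legendreP n).derivative.eval t * (legendreP m).derivative.eval t
      = (legendreP m).derivative.eval t * (legendreP n).derivative.eval t := fun t => mul_comm _ _
  simp only [e1, e2] at h2
  rw [← h2] at h1
  set I := ∫ t in (-1 : ℝ)..1, (legendreP m).eval t * (legendreP n).eval t
  have h3 : ((m : ℝ) - n) * (m + n + 1) * I = 0 := by linarith
  have h4 : ((m : ℝ) - n) ≠ 0 := sub_ne_zero.2 (by exact_mod_cast hmn)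
  have h5 : ((m : ℝ) + n + 1) ≠ 0 := by positivity
  exact (mul_eq_zero.1 h3).resolve_left (mul_ne_zero h4 h5)

/-- A linear functional on polynomials that kills `P_m` for `m < n` kills all polynomials of
degree less than `n`. -/
theorem linearMap_eq_zero_of_legendreP (Λ : Polynomial ℝ →ₗ[ℝ] ℝ) {n : ℕ}
    (h : ∀ m < n, Λ (legendreP m) = 0) {q : Polynomial ℝ} (hq : q.degree < n) : Λ q = 0 := by
  induction n generalizing q with
  | zero =>
    have : q = 0 := by simpa using hq
    simp [this]
  | succ n ih =>
    have hlc : (legendreP n).coeff n ≠ 0 := by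
      have := legendreP_ne_zero n
      rw [← Polynomial.leadingCoeff_ne_zero, Polynomial.leadingCoeff, natDegree_legendreP] at this
      exact this
    set c := q.coeff n / (legendreP n).coeff n
    have hdeg : (q - c • legendreP n).degree < n := by
      rw [Polynomial.degree_lt_iff_coeff_zero]
      intro k hk
      rcases eq_or_lt_of_le hk with rfl | hk
      · simp [c, hlc]
      · rw [Polynomial.coeff_sub, Polynomial.coeff_smul,
          Polynomial.coeff_eq_zero_of_degree_lt (hq.trans_le (by exact_mod_cast hk)),
          Polynomial.coeff_eq_zero_of_natDegree_lt (by rw [natDegree_legendreP]; exact hk)]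
        simp
    have := ih (fun m hm => h m (by omega)) hdeg
    rw [map_sub, map_smul, h n (by omega)] at this
    simpa using this

/-- Integration over `[-1,1]` against a function, as a linear functional on polynomials. -/
noncomputable def integralAgainst (φ : ℝ → ℝ) (hφ : ContinuousOn φ (Set.Icc (-1) 1)) :
    Polynomial ℝ →ₗ[ℝ] ℝ where
  toFun q := ∫ t in (-1 : ℝ)..1, φ t * q.eval t
  map_add' p q := by
    have hi : ∀ q : Polynomial ℝ, IntervalIntegrable (fun t => φ t * q.eval t) volume (-1) 1 := by
      intro q
      apply ContinuousOn.intervalIntegrable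
      rw [Set.uIcc_of_le (by norm_num)]
      exact hφ.mul q.continuous.continuousOn
    simp only [Polynomial.eval_add, mul_add]
    exact intervalIntegral.integral_add (hi p) (hi q)
  map_smul' c q := by
    simp only [Polynomial.eval_smul, smul_eq_mul, RingHom.id_apply]
    rw [← intervalIntegral.integral_const_mul]
    congr 1
    ext t
    ring

/-- `X P' - ℓ P` has degree below `ℓ`, hence is orthogonal to `P`. Integrating `(tP²)' = P² + 2tPP'`
then gives `2 = (1 + 2ℓ) ∫ P²`. -/
theorem integral_legendreP_sq (ℓ : ℕ) :
    ∫ t in (-1 : ℝ)..1, (legendreP ℓ).eval t * (legendreP ℓ).eval t = 2 / (2 * ℓ + 1) := by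
  set P := legendreP ℓ with hP
  have hlow : integralAgainst (fun t => P.eval t) P.continuous.continuousOn
      (Polynomial.X * P.derivative - (ℓ : ℝ) • P) = 0 := by
    apply linearMap_eq_zero_of_legendreP (n := ℓ)
    · intro m hm
      exact integral_legendreP_mul_of_ne hm.ne'
    · rw [Polynomial.degree_lt_iff_coeff_zero]
      intro k hk
      rw [Polynomial.coeff_sub, Polynomial.coeff_smul]
      have : (Polynomial.X * P.derivative).coeff k = k * P.coeff k := by
        rcases k with _ | k
        · simp
        · rw [Polynomial.coeff_X_mul, Polynomial.coeff_derivative]; push_cast; ring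
      rw [this]
      rcases eq_or_lt_of_le hk with rfl | hk
      · simp
      · rw [Polynomial.coeff_eq_zero_of_natDegree_lt (by rw [hP, natDegree_legendreP]; exact hk)]
        simp
  have h := intervalIntegral.integral_eq_sub_of_hasDerivAt (a := -1) (b := 1)
    (f := fun t => (Polynomial.X * P * P).eval t)
    (f' := fun t => (Polynomial.X * P * P).derivative.eval t)
    (fun t _ => Polynomial.hasDerivAt _ t) ((Polynomial.continuous _).intervalIntegrable _ _)
  simp only [Polynomial.eval_mul, Polynomial.eval_X, hP, legendreP_eval_one,
    legendreP_eval_neg_one] at h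
  rw [← hP] at h
  have e1 : (-1 : ℝ) * (-1) ^ ℓ * (-1) ^ ℓ = -1 := by
    rw [mul_assoc, ← mul_pow]; simp
  rw [e1] at h
  rw [map_sub, map_smul] at hlow
  simp only [integralAgainst, LinearMap.coe_mk, AddHom.coe_mk, smul_eq_mul] at hlow
  have h2 : ∫ t in (-1 : ℝ)..1, (Polynomial.X * P * P).derivative.eval t
      = (∫ t in (-1 : ℝ)..1, P.eval t * P.eval t)
        + 2 * ∫ t in (-1 : ℝ)..1, P.eval t * (Polynomial.X * P.derivative).eval t := by
    rw [← intervalIntegral.integral_const_mul, ← intervalIntegral.integral_add]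
    · congr 1
      ext t
      simp
      ring
    · exact (P.continuous.mul P.continuous).intervalIntegrable _ _
    · exact (continuous_const.mul (P.continuous.mul (Polynomial.continuous _))).intervalIntegrable
        _ _
  rw [h2] at h
  rw [eq_div_iff (by positivity)]
  linarith

end SphereKernel

namespace SphereKernel

/-! ### Completeness of the Legendre polynomials -/

theorem eqOn_zero_of_integral_polynomial_eq_zero {φ : ℝ → ℝ}
    (hφ : ContinuousOn φ (Set.Icc (-1) 1)) (h : ∀ q, integralAgainst φ hφ q = 0) :
    ∀ t ∈ Set.Icc (-1 : ℝ) 1, φ t = 0 := by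
  have hint : ∀ f : ℝ → ℝ, ContinuousOn f (Set.Icc (-1) 1) →
      IntervalIntegrable f volume (-1) 1 := fun f hf => by
    apply ContinuousOn.intervalIntegrable
    rwa [Set.uIcc_of_le (by norm_num)]
  have hsq : ∫ t in (-1 : ℝ)..1, φ t * φ t ≤ 0 := by
    have hM : 0 ≤ ∫ t in (-1 : ℝ)..1, |φ t| :=
      intervalIntegral.integral_nonneg (by norm_num) fun _ _ => abs_nonneg _
    apply le_of_forall_pos_le_add
    intro ε hε
    set M := ∫ t in (-1 : ℝ)..1, |φ t| with hMdef
    -- The denominator is `M + 1` because `M` may be zero.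
    obtain ⟨q, hq⟩ := exists_polynomial_near_of_continuousOn (-1) 1 φ hφ (ε / (M + 1))
      (by positivity)
    have h1 : ∫ t in (-1 : ℝ)..1, φ t * φ t = ∫ t in (-1 : ℝ)..1, φ t * (φ t - q.eval t) := by
      have hq0 : ∫ t in (-1 : ℝ)..1, φ t * q.eval t = 0 := h q
      simp only [mul_sub]
      have hi1 : IntervalIntegrable (fun t => φ t * φ t) volume (-1) 1 := hint _ (hφ.mul hφ)
      have hi2 : IntervalIntegrable (fun t => φ t * q.eval t) volume (-1) 1 :=
        hint _ (hφ.mul q.continuous.continuousOn)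
      rw [intervalIntegral.integral_sub hi1 hi2, hq0, sub_zero]
    have h2 : ∫ t in (-1 : ℝ)..1, φ t * (φ t - q.eval t)
        ≤ ∫ t in (-1 : ℝ)..1, |φ t| * (ε / (M + 1)) := by
      apply intervalIntegral.integral_mono_on (by norm_num)
        (hint _ (hφ.mul (hφ.sub q.continuous.continuousOn)))
        (hint _ (hφ.abs.mul continuousOn_const))
      intro t ht
      calc φ t * (φ t - q.eval t) ≤ |φ t * (φ t - q.eval t)| := le_abs_self _
        _ = |φ t| * |q.eval t - φ t| := by rw [abs_mul, abs_sub_comm]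
        _ ≤ _ := mul_le_mul_of_nonneg_left (hq t ht).le (abs_nonneg _)
    rw [intervalIntegral.integral_mul_const, ← hMdef] at h2
    have h3 : M * (ε / (M + 1)) ≤ ε := by
      rw [mul_div_assoc', div_le_iff₀ (by positivity)]
      nlinarith
    linarith
  intro t ht
  by_contra hne
  have : 0 < ∫ t in (-1 : ℝ)..1, φ t * φ t :=
    intervalIntegral.integral_pos (by norm_num : (-1 : ℝ) < 1) (hφ.mul hφ)
      (fun x _ => mul_self_nonneg _) ⟨t, ht, mul_self_pos.2 hne⟩
  linarith

theorem uIoc_subset_Icc {s t : ℝ} (hs : s ∈ Set.Icc (-1 : ℝ) 1) (ht : t ∈ Set.uIoc (-1) s) :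
    t ∈ Set.Icc (-1 : ℝ) 1 := by
  rw [Set.uIoc_of_le hs.1] at ht
  exact ⟨ht.1.le, ht.2.trans hs.2⟩

theorem summable_mul_legendreP {b : ℕ → ℝ} (hb : Summable fun ℓ => |b ℓ|) {t : ℝ}
    (ht : t ∈ Set.Icc (-1 : ℝ) 1) : Summable fun ℓ => b ℓ * (legendreP ℓ).eval t := by
  refine Summable.of_norm_bounded hb fun ℓ => ?_
  rw [Real.norm_eq_abs, abs_mul]
  exact mul_le_of_le_one_right (abs_nonneg _) (abs_legendreP_le_one ℓ ht)

/-- Absolutely convergent Legendre series may be integrated term by term. -/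
theorem hasSum_integral_legendre_series {b : ℕ → ℝ} (hb : Summable fun ℓ => |b ℓ|)
    (q : Polynomial ℝ) {s : ℝ} (hs : s ∈ Set.Icc (-1 : ℝ) 1) :
    HasSum (fun ℓ => ∫ t in (-1 : ℝ)..s, b ℓ * (legendreP ℓ).eval t * q.eval t)
      (∫ t in (-1 : ℝ)..s, (∑' ℓ, b ℓ * (legendreP ℓ).eval t) * q.eval t) := by
  obtain ⟨M, hM⟩ := (isCompact_Icc (a := (-1 : ℝ)) (b := 1)).exists_bound_of_continuousOn
    q.continuous.continuousOn
  refine intervalIntegral.hasSum_integral_of_dominated_convergence (fun ℓ _ => |b ℓ| * M)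
    (fun ℓ => ?_) (fun ℓ => ?_) ?_ ?_ ?_
  · exact ((continuous_const.mul (Polynomial.continuous _)).mul
      (Polynomial.continuous _)).aestronglyMeasurable
  · refine Eventually.of_forall fun t ht => ?_
    have ht' := uIoc_subset_Icc hs ht
    rw [norm_mul, norm_mul]
    refine mul_le_mul ?_ (hM t ht') (norm_nonneg _) (abs_nonneg _)
    exact mul_le_of_le_one_right (abs_nonneg _) (abs_legendreP_le_one ℓ ht')
  · exact Eventually.of_forall fun t _ => hb.mul_right M
  · exact intervalIntegrable_const
  · refine Eventually.of_forall fun t ht => ?_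
    exact (summable_mul_legendreP hb (uIoc_subset_Icc hs ht)).hasSum.mul_right _

theorem continuousOn_legendre_series {b : ℕ → ℝ} (hb : Summable fun ℓ => |b ℓ|) :
    ContinuousOn (fun t => ∑' ℓ, b ℓ * (legendreP ℓ).eval t) (Set.Icc (-1) 1) := by
  refine continuousOn_tsum (fun ℓ => (continuous_const.mul (Polynomial.continuous _)).continuousOn)
    hb fun ℓ t ht => ?_
  rw [Real.norm_eq_abs, abs_mul]
  exact mul_le_of_le_one_right (abs_nonneg _) (abs_legendreP_le_one ℓ ht)

variable {ψ : ℝ → ℝ}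

theorem summable_legendre_coeff
    (hsum : Summable fun ℓ : ℕ => (ℓ : ℝ) * |fourierLegendreCoeff ψ ℓ|) :
    Summable fun ℓ : ℕ => |(2 * (ℓ : ℝ) + 1) / (4 * Real.pi) * fourierLegendreCoeff ψ ℓ| := by
  -- The factor `ℓ` in the hypothesis vanishes at `ℓ = 0`, so the comparison with `3ℓ` is made for
  -- `ℓ ≥ 1` only.
  rw [← summable_nat_add_iff 1]
  refine Summable.of_nonneg_of_le (fun _ => abs_nonneg _) (fun n => ?_)
    (((summable_nat_add_iff 1).2 hsum).mul_left 3)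
  rw [abs_mul, ← mul_assoc]
  refine mul_le_mul_of_nonneg_right ?_ (abs_nonneg _)
  rw [abs_of_nonneg (by positivity), div_le_iff₀ (by positivity)]
  push_cast
  have h1 := Real.pi_gt_three
  have h2 : (0 : ℝ) ≤ n := by positivity
  nlinarith

/-- The Fourier-Legendre expansion of a continuous function with summable coefficients. -/
theorem hasSum_fourierLegendre (hψ : ContinuousOn ψ (Set.Icc (-1) 1))
    (hsum : Summable fun ℓ : ℕ => (ℓ : ℝ) * |fourierLegendreCoeff ψ ℓ|) {t : ℝ}
    (ht : t ∈ Set.Icc (-1 : ℝ) 1) :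
    HasSum (fun ℓ : ℕ => (2 * (ℓ : ℝ) + 1) / (4 * Real.pi) * fourierLegendreCoeff ψ ℓ
      * (legendreP ℓ).eval t) (ψ t) := by
  have hb := summable_legendre_coeff hsum
  set b : ℕ → ℝ := fun ℓ => (2 * (ℓ : ℝ) + 1) / (4 * Real.pi) * fourierLegendreCoeff ψ ℓ with hbdef
  have hS := continuousOn_legendre_series hb
  have hφ : ContinuousOn (fun t => ψ t - ∑' ℓ, b ℓ * (legendreP ℓ).eval t) (Set.Icc (-1) 1) :=
    hψ.sub hS
  have hP : ∀ m, integralAgainst _ hφ (legendreP m) = 0 := by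
    intro m
    have h1 := hasSum_integral_legendre_series hb (legendreP m)
      (s := 1) ⟨by norm_num, le_rfl⟩
    -- Only `ℓ = m` survives, so the series has the same integral against `P_m` as `ψ`. Completeness
    -- then forces the difference to vanish.
    have h2 : HasSum (fun ℓ => ∫ t in (-1 : ℝ)..1,
        b ℓ * (legendreP ℓ).eval t * (legendreP m).eval t)
        (∫ t in (-1 : ℝ)..1, b m * (legendreP m).eval t * (legendreP m).eval t) := by
      apply hasSum_single
      intro ℓ hℓ
      simp only [mul_assoc]
      rw [intervalIntegral.integral_const_mul, integral_legendreP_mul_of_ne hℓ, mul_zero]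
    have h3 := h1.unique h2
    simp only [mul_assoc (b m), intervalIntegral.integral_const_mul, integral_legendreP_sq] at h3
    change ∫ t in (-1 : ℝ)..1, (ψ t - ∑' ℓ, b ℓ * (legendreP ℓ).eval t) * (legendreP m).eval t = 0
    simp only [sub_mul]
    rw [intervalIntegral.integral_sub, h3]
    · simp only [hbdef, fourierLegendreCoeff]
      field_simp
      ring
    · apply ContinuousOn.intervalIntegrable
      rw [Set.uIcc_of_le (by norm_num)]
      exact hψ.mul (Polynomial.continuous _).continuousOn
    · apply ContinuousOn.intervalIntegrable
      rw [Set.uIcc_of_le (by norm_num)]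
      exact hS.mul (Polynomial.continuous _).continuousOn
  have h0 := eqOn_zero_of_integral_polynomial_eq_zero hφ (fun q =>
    linearMap_eq_zero_of_legendreP _ (n := q.natDegree + 1) (fun m _ => hP m)
      (lt_of_le_of_lt Polynomial.degree_le_natDegree (by exact_mod_cast Nat.lt_succ_self _))) t ht
  have := (summable_mul_legendreP hb ht).hasSum
  rwa [← sub_eq_zero.1 h0] at this

/-! ### The auxiliary function -/

/-- The coefficients in the expansion of the auxiliary function in derivatives of Legendre
polynomials. -/
noncomputable def kappaCoeff (ψ : ℝ → ℝ) (ℓ : ℕ) : ℝ :=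
  (2 * (ℓ : ℝ) + 1) / (4 * Real.pi * (ℓ * (ℓ + 1))) * fourierLegendreCoeff ψ ℓ

theorem kappaCoeff_mul {ℓ : ℕ} (hℓ : ℓ ≠ 0) : (ℓ * (ℓ + 1)) * kappaCoeff ψ ℓ
    = (2 * (ℓ : ℝ) + 1) / (4 * Real.pi) * fourierLegendreCoeff ψ ℓ := by
  have : (ℓ : ℝ) ≠ 0 := by exact_mod_cast hℓ
  have : (ℓ : ℝ) + 1 ≠ 0 := by positivity
  rw [kappaCoeff]
  field_simp

theorem summable_kappaCoeff
    (hsum : Summable fun ℓ : ℕ => (ℓ : ℝ) * |fourierLegendreCoeff ψ ℓ|) :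
    Summable fun n : ℕ => (((n + 1 : ℕ) : ℝ) * ((n + 1 : ℕ) + 1)) * |kappaCoeff ψ (n + 1)| := by
  refine ((summable_nat_add_iff 1).2 (summable_legendre_coeff hsum)).congr fun n => ?_
  rw [← kappaCoeff_mul (Nat.succ_ne_zero n), abs_mul, abs_of_nonneg (by positivity)]

theorem integral_legendreP {ℓ : ℕ} (hℓ : ℓ ≠ 0) (t : ℝ) :
    ∫ s in (-1 : ℝ)..t, (legendreP ℓ).eval s
      = -((1 - t ^ 2) * (legendreP ℓ).derivative.eval t / (ℓ * (ℓ + 1))) := by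
  have hl : (ℓ : ℝ) * (ℓ + 1) ≠ 0 := by positivity
  have h := intervalIntegral.integral_eq_sub_of_hasDerivAt (a := -1) (b := t)
    (f := fun s => ((Polynomial.X ^ 2 - 1) * (legendreP ℓ).derivative).eval s)
    (f' := fun s => ((Polynomial.X ^ 2 - 1) * (legendreP ℓ).derivative).derivative.eval s)
    (fun t _ => Polynomial.hasDerivAt _ t) ((Polynomial.continuous _).intervalIntegrable _ _)
  have e : ((Polynomial.X ^ 2 - 1) * (legendreP ℓ).derivative).derivative
      = Polynomial.C ((ℓ : ℝ) * (ℓ + 1)) * legendreP ℓ := by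
    have := legendreP_ode ℓ
    simp only [Polynomial.derivative_mul, Polynomial.derivative_sub, Polynomial.derivative_X_pow,
      Polynomial.derivative_one, map_mul, map_add, map_one, map_natCast, Nat.cast_ofNat,
      show (Polynomial.C (2 : ℝ)) = 2 from map_ofNat _ 2]
    linear_combination this
  rw [e] at h
  simp only [Polynomial.eval_mul, Polynomial.eval_C, intervalIntegral.integral_const_mul,
    Polynomial.eval_sub, Polynomial.eval_pow, Polynomial.eval_X, Polynomial.eval_one] at h
  field_simp
  linear_combination h

theorem hasSum_kappaQuotient (hψ : ContinuousOn ψ (Set.Icc (-1) 1))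
    (hψ0 : fourierLegendreCoeff ψ 0 = 1)
    (hsum : Summable fun ℓ : ℕ => (ℓ : ℝ) * |fourierLegendreCoeff ψ ℓ|) {t : ℝ}
    (ht : t ∈ Set.Ioo (-1 : ℝ) 1) :
    HasSum (fun n => kappaCoeff ψ (n + 1) * (legendreP (n + 1)).derivative.eval t)
      (kappaQuotient ψ t) := by
  have htI : t ∈ Set.Icc (-1 : ℝ) 1 := ⟨ht.1.le, ht.2.le⟩
  have h1t : 1 - t ^ 2 ≠ 0 := by nlinarith [ht.1, ht.2]
  have hb := summable_legendre_coeff hsum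
  have h := hasSum_integral_legendre_series hb 1 htI
  simp only [Polynomial.eval_one, mul_one] at h
  have e1 : ∫ s in (-1 : ℝ)..t, (∑' ℓ : ℕ, (2 * (ℓ : ℝ) + 1) / (4 * Real.pi)
      * fourierLegendreCoeff ψ ℓ * (legendreP ℓ).eval s) = ∫ s in (-1 : ℝ)..t, ψ s := by
    apply intervalIntegral.integral_congr
    intro s hs
    rw [Set.uIcc_of_le htI.1] at hs
    exact (hasSum_fourierLegendre hψ hsum ⟨hs.1, hs.2.trans htI.2⟩).tsum_eq
  -- Split off `ℓ = 0`: since `ψ̂(0) = 1` it is the constant `1/(4π)`, which cancels the `1` in the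
  -- integrand of `kappaQuotient`.
  rw [e1, ← hasSum_nat_add_iff' 1] at h
  simp only [Finset.range_one, Finset.sum_singleton, hψ0, legendreP_zero] at h
  have hval : kappaQuotient ψ t = -1 / (1 - t ^ 2) * ((∫ s in (-1 : ℝ)..t, ψ s)
      - ∫ s in (-1 : ℝ)..t, (2 * ((0 : ℕ) : ℝ) + 1) / (4 * Real.pi) * 1
        * (1 : Polynomial ℝ).eval s) := by
    have hint : IntervalIntegrable ψ volume (-1) t := by
      apply ContinuousOn.intervalIntegrable
      rw [Set.uIcc_of_le htI.1]
      exact hψ.mono (Set.Icc_subset_Icc_right htI.2)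
    rw [kappaQuotient, intervalIntegral.integral_sub (by simp) (hint.const_mul _),
      intervalIntegral.integral_const_mul]
    simp
    field_simp
    ring
  rw [hval]
  refine (congrArg (fun f => HasSum f _) (funext fun n => ?_)).mpr (h.mul_left (-1 / (1 - t ^ 2)))
  · rw [intervalIntegral.integral_const_mul, integral_legendreP (Nat.succ_ne_zero n),
      ← kappaCoeff_mul (Nat.succ_ne_zero n)]
    have : ((n + 1 : ℕ) : ℝ) * ((n + 1 : ℕ) + 1) ≠ 0 := by positivity
    field_simp

/-- The expansion of the auxiliary function in derivatives of Legendre polynomials. -/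
noncomputable def kappaSeries (ψ : ℝ → ℝ) (t : ℝ) : ℝ :=
  ∑' n, kappaCoeff ψ (n + 1) * (legendreP (n + 1)).derivative.eval t

theorem norm_kappaCoeff_mul_derivative_le (ℓ : ℕ) {t : ℝ} (ht : t ∈ Set.Icc (-1 : ℝ) 1) :
    ‖kappaCoeff ψ ℓ * (legendreP ℓ).derivative.eval t‖
      ≤ (ℓ * (ℓ + 1)) * |kappaCoeff ψ ℓ| := by
  rw [Real.norm_eq_abs, abs_mul, mul_comm]
  refine mul_le_mul_of_nonneg_right ?_ (abs_nonneg _)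
  have : (0 : ℝ) ≤ ℓ * (ℓ + 1) := by positivity
  linarith [abs_derivative_legendreP_le ℓ ht]

theorem hasSum_kappaSeries
    (hsum : Summable fun ℓ : ℕ => (ℓ : ℝ) * |fourierLegendreCoeff ψ ℓ|) {t : ℝ}
    (ht : t ∈ Set.Icc (-1 : ℝ) 1) :
    HasSum (fun n => kappaCoeff ψ (n + 1) * (legendreP (n + 1)).derivative.eval t)
      (kappaSeries ψ t) :=
  (Summable.of_norm_bounded (summable_kappaCoeff hsum) fun n =>
    norm_kappaCoeff_mul_derivative_le (n + 1) ht).hasSum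

theorem continuousOn_kappaSeries
    (hsum : Summable fun ℓ : ℕ => (ℓ : ℝ) * |fourierLegendreCoeff ψ ℓ|) :
    ContinuousOn (kappaSeries ψ) (Set.Icc (-1) 1) :=
  continuousOn_tsum
    (fun _ => (continuous_const.mul (Polynomial.continuous _)).continuousOn)
    (summable_kappaCoeff hsum) fun n _ ht => norm_kappaCoeff_mul_derivative_le (n + 1) ht

theorem kappaQuotient_eq_kappaSeries (hψ : ContinuousOn ψ (Set.Icc (-1) 1))
    (hψ0 : fourierLegendreCoeff ψ 0 = 1)
    (hsum : Summable fun ℓ : ℕ => (ℓ : ℝ) * |fourierLegendreCoeff ψ ℓ|) {t : ℝ}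
    (ht : t ∈ Set.Ioo (-1 : ℝ) 1) : kappaQuotient ψ t = kappaSeries ψ t :=
  (hasSum_kappaQuotient hψ hψ0 hsum ht).unique (hasSum_kappaSeries hsum ⟨ht.1.le, ht.2.le⟩)

/-- The series is continuous on the closed interval and agrees with the quotient inside, so the
limits that define `kappa` at the endpoints exist. -/
theorem kappa_eq_kappaSeries (hψ : ContinuousOn ψ (Set.Icc (-1) 1))
    (hψ0 : fourierLegendreCoeff ψ 0 = 1)
    (hsum : Summable fun ℓ : ℕ => (ℓ : ℝ) * |fourierLegendreCoeff ψ ℓ|) {t : ℝ}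
    (ht : t ∈ Set.Icc (-1 : ℝ) 1) : kappa ψ t = kappaSeries ψ t := by
  apply extendFrom_eq
  · rwa [closure_Ioo (by norm_num)]
  · refine (((continuousOn_kappaSeries hsum) t ht).mono Set.Ioo_subset_Icc_self).tendsto.congr' ?_
    filter_upwards [self_mem_nhdsWithin] with s hs
    exact (kappaQuotient_eq_kappaSeries hψ hψ0 hsum hs).symm

theorem kappa_eq_kappaQuotient (hψ : ContinuousOn ψ (Set.Icc (-1) 1))
    (hψ0 : fourierLegendreCoeff ψ 0 = 1)
    (hsum : Summable fun ℓ : ℕ => (ℓ : ℝ) * |fourierLegendreCoeff ψ ℓ|) {t : ℝ}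
    (ht : t ∈ Set.Ioo (-1 : ℝ) 1) : kappa ψ t = kappaQuotient ψ t := by
  rw [kappa_eq_kappaSeries hψ hψ0 hsum ⟨ht.1.le, ht.2.le⟩,
    kappaQuotient_eq_kappaSeries hψ hψ0 hsum ht]

theorem hasDerivAt_kappaQuotient (hψ : ContinuousOn ψ (Set.Icc (-1) 1)) {t : ℝ}
    (ht : t ∈ Set.Ioo (-1 : ℝ) 1) :
    HasDerivAt (kappaQuotient ψ) ((2 * t * kappaQuotient ψ t + (1 / (4 * Real.pi) - ψ t))
      / (1 - t ^ 2)) t := by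
  have h1t : 1 - t ^ 2 ≠ 0 := by nlinarith [ht.1, ht.2]
  have hc : ContinuousOn (fun s => 1 - 4 * Real.pi * ψ s) (Set.Icc (-1) 1) :=
    continuousOn_const.sub (continuousOn_const.mul hψ)
  have hJ : HasDerivAt (fun u => ∫ s in (-1 : ℝ)..u, (1 - 4 * Real.pi * ψ s))
      (1 - 4 * Real.pi * ψ t) t := by
    apply intervalIntegral.integral_hasDerivAt_right
    · apply ContinuousOn.intervalIntegrable
      rw [Set.uIcc_of_le ht.1.le]
      exact hc.mono (Set.Icc_subset_Icc_right ht.2.le)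
    · exact (hc.mono Set.Ioo_subset_Icc_self).stronglyMeasurableAtFilter isOpen_Ioo t ht
    · exact hc.continuousAt (Icc_mem_nhds ht.1 ht.2)
  have hden : HasDerivAt (fun u : ℝ => 4 * Real.pi * (1 - u ^ 2)) (4 * Real.pi * (-(2 * t))) t := by
    have := (((hasDerivAt_pow 2 t).const_sub 1).const_mul (4 * Real.pi))
    simpa using this
  have hd := ((hasDerivAt_const t (1 : ℝ)).div hden (by positivity)).mul hJ
  refine hd.congr_deriv ?_
  simp only [kappaQuotient, Pi.div_apply]
  field_simp
  ring

/-- No termwise differentiation is needed: `(1-t²)κ' = 2tκ + 1/(4π) - ψ`, and the Legendre equation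
combines the expansions of `κ` and `ψ` on the right, coefficient by coefficient, into `(1-t²)P_ℓ''`.
-/
theorem hasSum_deriv_kappa (hψ : ContinuousOn ψ (Set.Icc (-1) 1))
    (hψ0 : fourierLegendreCoeff ψ 0 = 1)
    (hsum : Summable fun ℓ : ℕ => (ℓ : ℝ) * |fourierLegendreCoeff ψ ℓ|) {t : ℝ}
    (ht : t ∈ Set.Ioo (-1 : ℝ) 1) :
    HasSum (fun n => kappaCoeff ψ (n + 1) * (legendreP (n + 1)).derivative.derivative.eval t)
      (deriv (kappa ψ) t) := by
  have h1t : 1 - t ^ 2 ≠ 0 := by nlinarith [ht.1, ht.2]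
  have hd : deriv (kappa ψ) t = (2 * t * kappaQuotient ψ t + (1 / (4 * Real.pi) - ψ t))
      / (1 - t ^ 2) := by
    refine ((hasDerivAt_kappaQuotient hψ ht).congr_of_eventuallyEq ?_).deriv
    filter_upwards [Ioo_mem_nhds ht.1 ht.2] with s hs
    exact kappa_eq_kappaQuotient hψ hψ0 hsum hs
  have h1 := (hasSum_kappaQuotient hψ hψ0 hsum ht).mul_left (2 * t)
  have h2 := (hasSum_nat_add_iff' 1).2 (hasSum_fourierLegendre hψ hsum
    (⟨ht.1.le, ht.2.le⟩ : t ∈ Set.Icc (-1 : ℝ) 1))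
  simp only [Finset.range_one, Finset.sum_singleton, hψ0, legendreP_zero] at h2
  have hval : (2 * t * kappaQuotient ψ t + (1 / (4 * Real.pi) - ψ t)) / (1 - t ^ 2)
      = (2 * t * kappaQuotient ψ t - (ψ t - (2 * ((0 : ℕ) : ℝ) + 1) / (4 * Real.pi) * 1
        * (1 : Polynomial ℝ).eval t)) / (1 - t ^ 2) := by
    simp
    ring
  rw [hd, hval]
  refine (congrArg (fun f => HasSum f _) (funext fun n => ?_)).mpr ((h1.sub h2).div_const (1 - t ^ 2))
  rw [← kappaCoeff_mul (Nat.succ_ne_zero n), eq_div_iff h1t]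
  linear_combination kappaCoeff ψ (n + 1) * legendreP_ode_eval (n + 1) t

theorem differentiableOn_kappa (hψ : ContinuousOn ψ (Set.Icc (-1) 1))
    (hψ0 : fourierLegendreCoeff ψ 0 = 1)
    (hsum : Summable fun ℓ : ℕ => (ℓ : ℝ) * |fourierLegendreCoeff ψ ℓ|) :
    DifferentiableOn ℝ (kappa ψ) (Set.Ioo (-1) 1) := fun t ht =>
  ((hasDerivAt_kappaQuotient hψ ht).congr_of_eventuallyEq (by
    filter_upwards [Ioo_mem_nhds ht.1 ht.2] with s hs
    exact kappa_eq_kappaQuotient hψ hψ0 hsum hs)).differentiableAt.differentiableWithinAt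

end SphereKernel

namespace SphereKernel

/-! ### Zonal harmonic polynomials -/

theorem pderiv_pderiv_comm {σ : Type*} (i j : σ) (p : MvPolynomial σ ℝ) :
    MvPolynomial.pderiv i (MvPolynomial.pderiv j p)
      = MvPolynomial.pderiv j (MvPolynomial.pderiv i p) := by
  classical
  induction p using MvPolynomial.induction_on with
  | C a => simp
  | add p q hp hq => simp [hp, hq]
  | mul_X p k hp =>
    simp only [MvPolynomial.pderiv_mul, map_add, MvPolynomial.pderiv_X, hp]
    simp only [Pi.single_apply]
    split_ifs <;> simp <;> ring

theorem hasDerivAt_eval_comp {σ : Type*} [Fintype σ] (p : MvPolynomial σ ℝ) {c : ℝ → σ → ℝ}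
    {c' : σ → ℝ} {θ : ℝ} (hc : ∀ i, HasDerivAt (fun u => c u i) (c' i) θ) :
    HasDerivAt (fun u => MvPolynomial.eval (c u) p)
      (∑ i, MvPolynomial.eval (c θ) (MvPolynomial.pderiv i p) * c' i) θ := by
  classical
  induction p using MvPolynomial.induction_on with
  | C a => simpa using hasDerivAt_const θ a
  | add p q hp hq =>
    simp only [map_add, add_mul, Finset.sum_add_distrib]
    exact hp.add hq
  | mul_X p k hp =>
    simp only [map_mul, MvPolynomial.eval_X]
    refine (hp.mul (hc k)).congr_deriv ?_
    simp only [MvPolynomial.pderiv_mul, map_add, map_mul, MvPolynomial.eval_X, add_mul,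
      Finset.sum_add_distrib, MvPolynomial.pderiv_X]
    congr 1
    · rw [Finset.sum_mul]
      exact Finset.sum_congr rfl fun i _ => by ring
    · rw [Finset.sum_eq_single k]
      · simp
      · intro i _ hi
        simp [hi.symm]
      · simp

/-- Second derivatives, along a curve on the sphere, of a polynomial that depends only on the
last coordinate there. -/
theorem second_deriv_zonal {p : MvPolynomial (Fin 3) ℝ} {g : Polynomial ℝ}
    (hg : ∀ x : Fin 3 → ℝ, ∑ i, x i ^ 2 = 1 → MvPolynomial.eval x p = g.eval (x 2))
    {c c₁ c₂ : ℝ → Fin 3 → ℝ} (hc : ∀ θ i, HasDerivAt (fun u => c u i) (c₁ θ i) θ)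
    (hc₁ : ∀ θ i, HasDerivAt (fun u => c₁ u i) (c₂ θ i) θ) (hunit : ∀ θ, ∑ i, c θ i ^ 2 = 1)
    (θ : ℝ) :
    ∑ i, ((∑ j, MvPolynomial.eval (c θ) (MvPolynomial.pderiv j (MvPolynomial.pderiv i p))
        * c₁ θ j) * c₁ θ i + MvPolynomial.eval (c θ) (MvPolynomial.pderiv i p) * c₂ θ i)
      = g.derivative.derivative.eval (c θ 2) * c₁ θ 2 ^ 2 + g.derivative.eval (c θ 2) * c₂ θ 2 := by
  have h1 : ∀ θ, ∑ i, MvPolynomial.eval (c θ) (MvPolynomial.pderiv i p) * c₁ θ i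
      = g.derivative.eval (c θ 2) * c₁ θ 2 := by
    intro θ
    have e1 := hasDerivAt_eval_comp p (hc θ)
    have e2 := (g.hasDerivAt (c θ 2)).comp θ (hc θ 2)
    refine e1.unique (e2.congr_of_eventuallyEq (Eventually.of_forall fun u => ?_))
    exact hg _ (hunit u)
  have e1 : HasDerivAt (fun θ => ∑ i, MvPolynomial.eval (c θ) (MvPolynomial.pderiv i p) * c₁ θ i)
      _ θ := HasDerivAt.fun_sum fun i _ =>
        (hasDerivAt_eval_comp (MvPolynomial.pderiv i p) (hc θ)).mul (hc₁ θ i)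
  have e2 := ((g.derivative.hasDerivAt (c θ 2)).comp θ (hc θ 2)).mul (hc₁ θ 2)
  refine e1.unique ((e2.congr_deriv ?_).congr_of_eventuallyEq (Eventually.of_forall fun u => ?_))
  · simp only [Function.comp]
    ring
  · exact h1 u

/-- Even powers of `s` are removed by `s² = 1 - t²`. For a zonal polynomial the values at `s` and
`-s` agree, so only `A` remains. -/
theorem exists_polynomial_restrict_circle (p : MvPolynomial (Fin 3) ℝ) :
    ∃ A B : Polynomial ℝ, ∀ s t : ℝ, s ^ 2 + t ^ 2 = 1 →
      MvPolynomial.eval ![s, 0, t] p = A.eval t + s * B.eval t := by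
  induction p using MvPolynomial.induction_on with
  | C a => exact ⟨Polynomial.C a, 0, fun s t _ => by simp⟩
  | add p q hp hq =>
    obtain ⟨A, B, h⟩ := hp
    obtain ⟨A', B', h'⟩ := hq
    refine ⟨A + A', B + B', fun s t hst => ?_⟩
    rw [map_add, h s t hst, h' s t hst, Polynomial.eval_add, Polynomial.eval_add]
    ring
  | mul_X p k hp =>
    obtain ⟨A, B, h⟩ := hp
    fin_cases k
    · refine ⟨(1 - Polynomial.X ^ 2) * B, A, fun s t hst => ?_⟩
      rw [map_mul, h s t hst, MvPolynomial.eval_X]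
      simp
      linear_combination (B.eval t) * hst
    · exact ⟨0, 0, fun s t hst => by simp⟩
    · refine ⟨Polynomial.X * A, Polynomial.X * B, fun s t hst => ?_⟩
      rw [map_mul, h s t hst, MvPolynomial.eval_X]
      simp
      ring

/-- Euler's identity for `∂_i p`, obtained by differentiating that for `p`; this form avoids the
truncated degree `ℓ - 1`. -/
theorem euler_second {σ : Type*} [Fintype σ] {p : MvPolynomial σ ℝ} {ℓ : ℕ}
    (hp : p.IsHomogeneous ℓ) (i : σ) :
    MvPolynomial.pderiv i p + ∑ j, MvPolynomial.X j * MvPolynomial.pderiv i (MvPolynomial.pderiv j p)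
      = (ℓ : MvPolynomial σ ℝ) * MvPolynomial.pderiv i p := by
  classical
  have h := congrArg (MvPolynomial.pderiv i) hp.sum_X_mul_pderiv
  rw [map_sum, map_nsmul, nsmul_eq_mul] at h
  rw [← h]
  simp only [MvPolynomial.pderiv_mul, Finset.sum_add_distrib, MvPolynomial.pderiv_X]
  congr 1
  rw [Finset.sum_eq_single i]
  · simp
  · intro j _ hj
    simp [hj]
  · simp

/-- A harmonic homogeneous polynomial of degree `ℓ` whose values on the sphere depend only on the
last coordinate is a multiple of the Legendre polynomial. -/
theorem zonal_harmonic_eq {ℓ : ℕ} {p : MvPolynomial (Fin 3) ℝ} (hp : p.IsHomogeneous ℓ)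
    (hlap : ∑ i, MvPolynomial.pderiv i (MvPolynomial.pderiv i p) = 0)
    (hz : ∀ x x' : Fin 3 → ℝ, ∑ i, x i ^ 2 = 1 → ∑ i, x' i ^ 2 = 1 → x 2 = x' 2 →
      MvPolynomial.eval x p = MvPolynomial.eval x' p) {x : Fin 3 → ℝ} (hx : ∑ i, x i ^ 2 = 1) :
    MvPolynomial.eval x p = MvPolynomial.eval ![0, 0, 1] p * (legendreP ℓ).eval (x 2) := by
  obtain ⟨g, B, hgB⟩ := exists_polynomial_restrict_circle p
  have hg : ∀ x : Fin 3 → ℝ, ∑ i, x i ^ 2 = 1 → MvPolynomial.eval x p = g.eval (x 2) := by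
    intro x hx
    have hx' := hx
    rw [Fin.sum_univ_three] at hx'
    have hs : (√(1 - x 2 ^ 2)) ^ 2 = 1 - x 2 ^ 2 :=
      Real.sq_sqrt (by nlinarith [sq_nonneg (x 0), sq_nonneg (x 1)])
    have h1 := hz x ![√(1 - x 2 ^ 2), 0, x 2] hx (by simp [Fin.sum_univ_three, hs]) rfl
    have h2 := hz x ![-√(1 - x 2 ^ 2), 0, x 2] hx (by simp [Fin.sum_univ_three, hs]) rfl
    rw [hgB _ _ (by linarith)] at h1
    rw [hgB _ _ (by rw [neg_sq]; linarith)] at h2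
    linarith
  have hode : ∀ t ∈ Set.Icc (-1 : ℝ) 1, (t ^ 2 - 1) * g.derivative.derivative.eval t
      + 2 * t * g.derivative.eval t = ℓ * (ℓ + 1) * g.eval t := by
    intro t ht
    set s := √(1 - t ^ 2) with hsdef
    have hs : s ^ 2 = 1 - t ^ 2 := Real.sq_sqrt (by nlinarith [ht.1, ht.2])
    have hu : ∑ i, (![s, 0, t] : Fin 3 → ℝ) i ^ 2 = 1 := by simp [Fin.sum_univ_three, hs]
    -- The three curves rotate `(s,0,t)` about the coordinate axes. Their second derivatives at `0`
    -- add up to the spherical Laplacian there, which on a function of the last coordinate is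
    -- `(1-t²)g'' - 2tg'`.
    have d1 := second_deriv_zonal hg
      (c := fun θ => ![s * Real.cos θ + t * Real.sin θ, 0, t * Real.cos θ - s * Real.sin θ])
      (c₁ := fun θ => ![t * Real.cos θ - s * Real.sin θ, 0, -(s * Real.cos θ + t * Real.sin θ)])
      (c₂ := fun θ => ![-(s * Real.cos θ + t * Real.sin θ), 0,
        -(t * Real.cos θ - s * Real.sin θ)])
      (by
        intro θ i
        have hC := Real.hasDerivAt_cos θ
        have hS := Real.hasDerivAt_sin θ
        fin_cases i
        · exact ((hC.const_mul s).add (hS.const_mul t)).congr_deriv (by simp; ring)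
        · exact hasDerivAt_const _ _
        · exact ((hC.const_mul t).sub (hS.const_mul s)).congr_deriv (by simp; ring))
      (by
        intro θ i
        have hC := Real.hasDerivAt_cos θ
        have hS := Real.hasDerivAt_sin θ
        fin_cases i
        · exact ((hC.const_mul t).sub (hS.const_mul s)).congr_deriv (by simp; ring)
        · exact hasDerivAt_const _ _
        · exact ((hC.const_mul s).add (hS.const_mul t)).neg.congr_deriv (by simp; ring))
      (by
        intro θ
        simp [Fin.sum_univ_three]
        nlinarith [Real.sin_sq_add_cos_sq θ]) 0
    have d2 := second_deriv_zonal hg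
      (c := fun θ => ![s, t * Real.sin θ, t * Real.cos θ])
      (c₁ := fun θ => ![0, t * Real.cos θ, -(t * Real.sin θ)])
      (c₂ := fun θ => ![0, -(t * Real.sin θ), -(t * Real.cos θ)])
      (by
        intro θ i
        have hC := Real.hasDerivAt_cos θ
        have hS := Real.hasDerivAt_sin θ
        fin_cases i
        · exact hasDerivAt_const _ _
        · exact hS.const_mul t
        · exact (hC.const_mul t).congr_deriv (by simp))
      (by
        intro θ i
        have hC := Real.hasDerivAt_cos θ
        have hS := Real.hasDerivAt_sin θ
        fin_cases i
        · exact hasDerivAt_const _ _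
        · exact (hC.const_mul t).congr_deriv (by simp)
        · exact (hS.const_mul t).neg)
      (by
        intro θ
        simp [Fin.sum_univ_three]
        nlinarith [Real.sin_sq_add_cos_sq θ]) 0
    have d3 := second_deriv_zonal hg
      (c := fun θ => ![s * Real.cos θ, s * Real.sin θ, t])
      (c₁ := fun θ => ![-(s * Real.sin θ), s * Real.cos θ, 0])
      (c₂ := fun θ => ![-(s * Real.cos θ), -(s * Real.sin θ), 0])
      (by
        intro θ i
        have hC := Real.hasDerivAt_cos θ
        have hS := Real.hasDerivAt_sin θ
        fin_cases i
        · exact (hC.const_mul s).congr_deriv (by simp)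
        · exact hS.const_mul s
        · exact hasDerivAt_const _ _)
      (by
        intro θ i
        have hC := Real.hasDerivAt_cos θ
        have hS := Real.hasDerivAt_sin θ
        fin_cases i
        · exact (hS.const_mul s).neg
        · exact (hC.const_mul s).congr_deriv (by simp)
        · exact hasDerivAt_const _ _)
      (by
        intro θ
        simp [Fin.sum_univ_three]
        nlinarith [Real.sin_sq_add_cos_sq θ]) 0
    simp [Fin.sum_univ_three] at d1 d2 d3
    have e0 := congrArg (MvPolynomial.eval ![s, 0, t]) hp.sum_X_mul_pderiv
    have e1 := congrArg (MvPolynomial.eval ![s, 0, t]) (euler_second hp 0)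
    have e2 := congrArg (MvPolynomial.eval ![s, 0, t]) (euler_second hp 2)
    have e3 := congrArg (MvPolynomial.eval ![s, 0, t]) hlap
    simp [Fin.sum_univ_three] at e0 e1 e2 e3
    rw [pderiv_pderiv_comm 2 0 p] at d1 e2
    have hv := hg _ hu
    simp at hv
    rw [hv] at e0
    generalize MvPolynomial.eval ![s, 0, t] (MvPolynomial.pderiv 0 (MvPolynomial.pderiv 0 p)) = p00 at *
    generalize MvPolynomial.eval ![s, 0, t] (MvPolynomial.pderiv 1 (MvPolynomial.pderiv 1 p)) = p11 at *
    generalize MvPolynomial.eval ![s, 0, t] (MvPolynomial.pderiv 2 (MvPolynomial.pderiv 2 p)) = p22 at *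
    generalize MvPolynomial.eval ![s, 0, t] (MvPolynomial.pderiv 0 (MvPolynomial.pderiv 2 p)) = p02 at *
    generalize MvPolynomial.eval ![s, 0, t] (MvPolynomial.pderiv 0 p) = p0 at *
    generalize MvPolynomial.eval ![s, 0, t] (MvPolynomial.pderiv 2 p) = p2 at *
    generalize Polynomial.eval t (Polynomial.derivative (Polynomial.derivative g)) = g2 at *
    generalize Polynomial.eval t (Polynomial.derivative g) = g1 at *
    generalize Polynomial.eval t g = g0 at *
    -- The identity behind this is `r²Δ = Δ_sphere + E(E+1)` with `E` the Euler operator, here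
    -- acting as `ℓ`.
    linear_combination d1 + d2 + d3 + s * e1 + t * e2 + ((ℓ : ℝ) + 1) * e0
      - (s ^ 2 + t ^ 2) * e3 + g2 * hs
  have hpoly : (Polynomial.X ^ 2 - 1) * g.derivative.derivative + 2 * Polynomial.X * g.derivative
      = (ℓ : Polynomial ℝ) * ((ℓ : Polynomial ℝ) + 1) * g := by
    apply Polynomial.eq_of_infinite_eval_eq
    refine (Set.Icc_infinite (by norm_num : (-1 : ℝ) < 1)).mono fun t ht => ?_
    simpa using hode t ht
  rw [hg x hx, hg ![0, 0, 1] (by simp [Fin.sum_univ_three]), eq_smul_legendreP_of_ode hpoly]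
  simp [legendreP_eval_one]

end SphereKernel

namespace SphereKernel

/-! ### Isometries of the sphere -/

/-- The action of a linear isometry on the sphere. -/
noncomputable def sphereMap (A : E3 ≃ₗᵢ[ℝ] E3) (x : S2) : S2 := ⟨A x, by simp⟩

theorem continuous_sphereMap (A : E3 ≃ₗᵢ[ℝ] E3) : Continuous (sphereMap A) :=
  (A.continuous.comp continuous_subtype_val).subtype_mk _

theorem sphereMap_symm_apply (A : E3 ≃ₗᵢ[ℝ] E3) (x : S2) :
    sphereMap A (sphereMap A.symm x) = x := Subtype.ext (by simp [sphereMap])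

theorem sphereMap_apply_symm (A : E3 ≃ₗᵢ[ℝ] E3) (x : S2) :
    sphereMap A.symm (sphereMap A x) = x := Subtype.ext (by simp [sphereMap])

theorem dotp_sphereMap (A : E3 ≃ₗᵢ[ℝ] E3) (x y : S2) :
    dotp (sphereMap A x) (sphereMap A y) = dotp x y := by
  simp [dotp, sphereMap]

open scoped Pointwise in
-- The surface measure of a set is a multiple of the volume of the cone over it; a linear isometry
-- carries cones to cones and preserves volume.
theorem measurePreserving_sphereMap (A : E3 ≃ₗᵢ[ℝ] E3) :
    MeasurePreserving (sphereMap A) surfaceMeasure surfaceMeasure := by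
  have hm : Measurable (sphereMap A) := (continuous_sphereMap A).measurable
  refine ⟨hm, Measure.ext fun s hs => ?_⟩
  rw [Measure.map_apply hm hs, surfaceMeasure, Measure.toSphere_apply' _ hs,
    Measure.toSphere_apply' _ (hm hs)]
  congr 1
  have hA : MeasurePreserving A.toHomeomorph.toMeasurableEquiv volume volume := A.measurePreserving
  rw [← hA.measure_preimage_equiv (Set.Ioo (0 : ℝ) 1 • (Set.image Subtype.val s))]
  congr 1
  ext z
  simp only [Set.mem_smul, Set.mem_image, Set.mem_preimage]
  constructor
  · rintro ⟨r, hr, _, ⟨w, hw, rfl⟩, rfl⟩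
    exact ⟨r, hr, _, ⟨_, hw, rfl⟩, by simp [sphereMap]⟩
  · rintro ⟨r, hr, _, ⟨w, hw, rfl⟩, h⟩
    refine ⟨r, hr, _, ⟨sphereMap A.symm w, by rwa [sphereMap_symm_apply], rfl⟩, ?_⟩
    apply A.injective
    rw [map_smul]
    simpa [sphereMap] using h

theorem surfaceMeasure_univ : surfaceMeasure Set.univ = ENNReal.ofReal (4 * Real.pi) := by
  rw [surfaceMeasure, Measure.toSphere_apply_univ, EuclideanSpace.volume_ball_fin_three]
  simp only [ENNReal.ofReal_one, one_pow, one_mul, finrank_euclideanSpace, Fintype.card_fin]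
  rw [show ((3 : ℕ) : ENNReal) = ENNReal.ofReal 3 by simp, ← ENNReal.ofReal_mul (by norm_num)]
  congr 1
  ring

instance : IsFiniteMeasure surfaceMeasure := by
  unfold surfaceMeasure
  infer_instance

theorem dotp_self (x : S2) : dotp x x = 1 := by
  have : ‖(x : E3)‖ = 1 := by simp
  rw [dotp, real_inner_self_eq_norm_sq, this, one_pow]

/-- The isometry group acts transitively on pairs of points with a given inner product. -/
theorem exists_isometry_of_dotp_eq {x x' y : S2} (h : dotp x y = dotp x' y) :
    ∃ A : E3 ≃ₗᵢ[ℝ] E3, sphereMap A x = x' ∧ sphereMap A y = y := by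
  -- The reflection that exchanges `x` and `x'`; equal inner products put `y` on the mirror. If `x =
  -- x'` it is the identity.
  refine ⟨(ℝ ∙ ((x : E3) - x'))ᗮ.reflection, Subtype.ext ?_, Subtype.ext ?_⟩
  · exact Submodule.reflection_sub (by simp)
  · apply Submodule.reflection_mem_subspace_eq_self
    rw [Submodule.mem_orthogonal_singleton_iff_inner_right, inner_sub_left]
    exact sub_eq_zero.2 h

theorem exists_isometry (x y : S2) : ∃ A : E3 ≃ₗᵢ[ℝ] E3, sphereMap A x = y :=
  ⟨(ℝ ∙ ((x : E3) - y))ᗮ.reflection, Subtype.ext (Submodule.reflection_sub (by simp))⟩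

/-! ### Isometry invariance of spherical harmonics -/

theorem pderiv_bind₁ {σ : Type*} [Fintype σ] (f : σ → MvPolynomial σ ℝ) (i : σ)
    (p : MvPolynomial σ ℝ) :
    MvPolynomial.pderiv i (MvPolynomial.bind₁ f p)
      = ∑ j, MvPolynomial.bind₁ f (MvPolynomial.pderiv j p) * MvPolynomial.pderiv i (f j) := by
  classical
  induction p using MvPolynomial.induction_on with
  | C a => simp
  | add p q hp hq => simp [hp, hq, add_mul, Finset.sum_add_distrib]
  | mul_X p k hp =>
    simp only [map_mul, MvPolynomial.bind₁_X_right, MvPolynomial.pderiv_mul, hp, map_add, add_mul,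
      Finset.sum_add_distrib, MvPolynomial.pderiv_X]
    congr 1
    · rw [Finset.sum_mul]
      exact Finset.sum_congr rfl fun i _ => by ring
    · rw [Finset.sum_eq_single k]
      · simp
      · intro i _ hi
        simp [hi.symm]
      · simp

theorem IsSphericalHarmonic.comp_sphereMap {ℓ : ℕ} {f : S2 → ℝ} (hf : IsSphericalHarmonic ℓ f)
    (A : E3 ≃ₗᵢ[ℝ] E3) : IsSphericalHarmonic ℓ (f ∘ sphereMap A) := by
  obtain ⟨p, hp, hlap, hfp⟩ := hf
  set a : Fin 3 → Fin 3 → ℝ := fun j i => (A (EuclideanSpace.single i 1)).ofLp j with ha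
  have hA : ∀ (z : E3) j, (A z).ofLp j = ∑ i, a j i * z.ofLp i := by
    intro z j
    have hz : z = ∑ i, z.ofLp i • EuclideanSpace.single i (1 : ℝ) := by
      ext k
      simp [Finset.sum_apply, Pi.single_apply]
    conv_lhs => rw [hz, map_sum]
    simp [ha, mul_comm]
  have horth : ∀ j k, ∑ i, a j i * a k i = if j = k then 1 else 0 := by
    have h1 : ∀ k i, a k i = (A.symm (EuclideanSpace.single k 1)).ofLp i := by
      intro k i
      have := A.inner_map_map (EuclideanSpace.single i (1 : ℝ))
        (A.symm (EuclideanSpace.single k (1 : ℝ)))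
      simp only [LinearIsometryEquiv.apply_symm_apply] at this
      simpa [ha, EuclideanSpace.inner_single_left, EuclideanSpace.inner_single_right] using this
    intro j k
    have := hA (A.symm (EuclideanSpace.single k 1)) j
    simp only [← h1, LinearIsometryEquiv.apply_symm_apply] at this
    rw [← this]
    simp
  set F : Fin 3 → MvPolynomial (Fin 3) ℝ :=
    fun j => ∑ i, MvPolynomial.C (a j i) * MvPolynomial.X i with hF
  have hFd : ∀ i j, MvPolynomial.pderiv i (F j) = MvPolynomial.C (a j i) := by
    intro i j
    simp [hF, MvPolynomial.pderiv_X, Pi.single_apply]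
  refine ⟨MvPolynomial.bind₁ F p, ?_, ?_, ?_⟩
  · have := hp.aeval F (n := 1) (fun j => MvPolynomial.IsHomogeneous.sum _ _ _ fun i _ => by
      simpa using (MvPolynomial.isHomogeneous_C (Fin 3) (a j i)).mul
        (MvPolynomial.isHomogeneous_X ℝ i))
    rwa [one_mul] at this
  · have h : ∀ i, MvPolynomial.pderiv i (MvPolynomial.pderiv i (MvPolynomial.bind₁ F p))
        = ∑ j, ∑ k, MvPolynomial.bind₁ F (MvPolynomial.pderiv k (MvPolynomial.pderiv j p))
          * MvPolynomial.C (a k i * a j i) := by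
      intro i
      rw [pderiv_bind₁, map_sum]
      refine Finset.sum_congr rfl fun j _ => ?_
      rw [MvPolynomial.pderiv_mul, pderiv_bind₁, hFd, MvPolynomial.pderiv_C, mul_zero, add_zero,
        Finset.sum_mul]
      refine Finset.sum_congr rfl fun k _ => ?_
      rw [hFd, map_mul]
      ring
    simp only [h]
    rw [Finset.sum_comm]
    have h2 : ∀ j, ∑ i, ∑ k, MvPolynomial.bind₁ F (MvPolynomial.pderiv k (MvPolynomial.pderiv j p))
          * MvPolynomial.C (a k i * a j i)
        = MvPolynomial.bind₁ F (MvPolynomial.pderiv j (MvPolynomial.pderiv j p)) := by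
      intro j
      rw [Finset.sum_comm]
      simp only [← Finset.mul_sum, ← map_sum, horth]
      simp
    simp only [h2]
    rw [← map_sum, hlap, map_zero]
  · intro x
    rw [Function.comp, hfp]
    have : MvPolynomial.eval (vec x) (MvPolynomial.bind₁ F p)
        = MvPolynomial.eval (fun j => MvPolynomial.eval (vec x) (F j)) p := by
      simpa [MvPolynomial.aeval_eq_eval] using MvPolynomial.aeval_bind₁ (vec x) F p
    rw [this]
    congr 2
    ext j
    simp only [vec, sphereMap, hA, hF, map_sum, map_mul, MvPolynomial.eval_C, MvPolynomial.eval_X]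

theorem IsSphericalHarmonic.continuous {ℓ : ℕ} {f : S2 → ℝ} (hf : IsSphericalHarmonic ℓ f) :
    Continuous f := by
  obtain ⟨p, -, -, h⟩ := hf
  rw [show f = fun x => MvPolynomial.eval (vec x) p from funext h]
  have hv : Continuous vec := (PiLp.continuous_ofLp 2 _).comp continuous_subtype_val
  exact (MvPolynomial.continuous_eval p).comp hv

theorem integrable_of_continuous {f : S2 → ℝ} (hf : Continuous f) :
    Integrable f surfaceMeasure :=
  hf.integrable_of_hasCompactSupport (HasCompactSupport.of_compactSpace f)

/-! ### The addition theorem -/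

/-- Composition with `A` acts on the basis by a matrix, which is orthogonal because `A` preserves
the surface measure. -/
theorem sum_harmonics_sphereMap {ℓ : ℕ} {Y : Fin (2 * ℓ + 1) → S2 → ℝ}
    (hY : IsHarmonicOrthonormalBasis ℓ Y) (A : E3 ≃ₗᵢ[ℝ] E3) (x y : S2) :
    ∑ k, Y k (sphereMap A x) * Y k (sphereMap A y) = ∑ k, Y k x * Y k y := by
  have h1 : ∀ k, ∃ c : Fin (2 * ℓ + 1) → ℝ, ∑ j, c j • Y j = Y k ∘ sphereMap A := fun k =>
    (Submodule.mem_span_range_iff_exists_fun ℝ).1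
      (hY.spanning _ ((hY.harmonic k).comp_sphereMap A))
  choose M hM using h1
  have hM' : ∀ k z, Y k (sphereMap A z) = ∑ j, M k j * Y j z := by
    intro k z
    have := congrFun (hM k) z
    simpa using this.symm
  have hcont : ∀ k, Continuous (Y k) := fun k => (hY.harmonic k).continuous
  have hMM : (Matrix.of M) * (Matrix.of M)ᵀ = 1 := by
    ext j k
    have h2 : ∫ x, Y j (sphereMap A x) * Y k (sphereMap A x) ∂surfaceMeasure
        = if j = k then 1 else 0 := by
      rw [← hY.orthonormal j k]
      have hemb : MeasurableEmbedding (sphereMap A) :=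
        (Topology.IsClosedEmbedding.of_continuous_injective_isClosedMap (continuous_sphereMap A)
          (Function.LeftInverse.injective (sphereMap_apply_symm A))
          (continuous_sphereMap A).isClosedMap).measurableEmbedding
      exact (measurePreserving_sphereMap A).integral_comp hemb (fun z => Y j z * Y k z)
    rw [Matrix.one_apply, ← h2]
    simp only [hM', Finset.sum_mul_sum]
    rw [integral_finsetSum _ fun a _ => integrable_finsetSum _ fun b _ =>
      integrable_of_continuous (by fun_prop)]
    simp only [Matrix.mul_apply, Matrix.of_apply, Matrix.transpose_apply]
    refine Finset.sum_congr rfl fun a _ => ?_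
    rw [integral_finsetSum _ fun b _ => integrable_of_continuous (by fun_prop)]
    have : ∀ b, ∫ x, M j a * Y a x * (M k b * Y b x) ∂surfaceMeasure
        = M j a * M k b * if a = b then 1 else 0 := by
      intro b
      rw [← hY.orthonormal a b, ← integral_const_mul]
      congr 1
      ext x
      ring
    simp [this]
  -- The integrals give orthonormal rows; summing over `k` needs orthonormal columns, which follow
  -- for a square matrix.
  have hMM' : (Matrix.of M)ᵀ * (Matrix.of M) = 1 := mul_eq_one_comm.1 hMM
  have h3 : ∀ a b, ∑ k, M k a * M k b = if a = b then 1 else 0 := by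
    intro a b
    have := congrFun (congrFun hMM' a) b
    simpa [Matrix.mul_apply, Matrix.one_apply] using this
  simp only [hM', Finset.sum_mul_sum]
  rw [Finset.sum_comm]
  refine Finset.sum_congr rfl fun a _ => ?_
  rw [Finset.sum_comm]
  have : ∀ b, ∑ k, M k a * Y a x * (M k b * Y b y) = (if a = b then 1 else 0) * (Y a x * Y b y) := by
    intro b
    rw [← h3 a b, Finset.sum_mul]
    exact Finset.sum_congr rfl fun k _ => by ring
  simp [this]

/-- The north pole. -/
noncomputable def northPole : S2 := ⟨EuclideanSpace.single 2 1, by simp⟩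

theorem dotp_northPole (x : S2) : dotp x northPole = vec x 2 := by
  simp [dotp, northPole, vec, EuclideanSpace.inner_single_right]

theorem sum_vec_sq (x : S2) : ∑ i, vec x i ^ 2 = 1 := by
  have : ‖(x : E3)‖ = 1 := by simp
  rw [vec, ← EuclideanSpace.real_norm_sq_eq, this, one_pow]

theorem exists_vec_eq {v : Fin 3 → ℝ} (hv : ∑ i, v i ^ 2 = 1) : ∃ x : S2, vec x = v := by
  refine ⟨⟨WithLp.toLp 2 v, ?_⟩, rfl⟩
  rw [mem_sphere_zero_iff_norm, ← sq_eq_sq₀ (norm_nonneg _) zero_le_one,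
    EuclideanSpace.real_norm_sq_eq]
  simpa using hv

/-- The addition theorem for spherical harmonics. -/
theorem sum_harmonics_eq_legendreP {ℓ : ℕ} {Y : Fin (2 * ℓ + 1) → S2 → ℝ}
    (hY : IsHarmonicOrthonormalBasis ℓ Y) (x y : S2) :
    ∑ k, Y k x * Y k y = (2 * ℓ + 1) / (4 * Real.pi) * (legendreP ℓ).eval (dotp x y) := by
  choose p hp hlap hYp using hY.harmonic
  set q : MvPolynomial (Fin 3) ℝ := ∑ k, MvPolynomial.C (Y k northPole) * p k with hq
  have hqe : ∀ x, ∑ k, Y k x * Y k northPole = MvPolynomial.eval (vec x) q := by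
    intro x
    simp only [hq, map_sum, map_mul, MvPolynomial.eval_C, ← hYp, mul_comm]
  have hqh : q.IsHomogeneous ℓ := MvPolynomial.IsHomogeneous.sum _ _ _ fun k _ => by
    simpa using (MvPolynomial.isHomogeneous_C (Fin 3) (Y k northPole)).mul (hp k)
  have hql : ∑ i, MvPolynomial.pderiv i (MvPolynomial.pderiv i q) = 0 := by
    simp only [hq, map_sum, MvPolynomial.pderiv_C_mul]
    rw [Finset.sum_comm]
    simp only [← Finset.mul_sum, hlap, mul_zero, Finset.sum_const_zero]
  have hz : ∀ v v' : Fin 3 → ℝ, ∑ i, v i ^ 2 = 1 → ∑ i, v' i ^ 2 = 1 → v 2 = v' 2 →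
      MvPolynomial.eval v q = MvPolynomial.eval v' q := by
    intro v v' hv hv' hvv'
    obtain ⟨x, rfl⟩ := exists_vec_eq hv
    obtain ⟨x', rfl⟩ := exists_vec_eq hv'
    rw [← dotp_northPole, ← dotp_northPole] at hvv'
    obtain ⟨A, hA1, hA2⟩ := exists_isometry_of_dotp_eq hvv'
    rw [← hqe, ← hqe, ← sum_harmonics_sphereMap hY A, hA1, hA2]
  have hpole : ∀ x, ∑ k, Y k x * Y k northPole
      = MvPolynomial.eval ![0, 0, 1] q * (legendreP ℓ).eval (dotp x northPole) := by
    intro x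
    rw [hqe, dotp_northPole]
    exact zonal_harmonic_eq hqh hql hz (sum_vec_sq x)
  have hall : ∀ x y, ∑ k, Y k x * Y k y
      = MvPolynomial.eval ![0, 0, 1] q * (legendreP ℓ).eval (dotp x y) := by
    intro x y
    obtain ⟨A, hA⟩ := exists_isometry y northPole
    rw [← sum_harmonics_sphereMap hY A, ← dotp_sphereMap A, hA, hpole]
  -- Integrate over the diagonal: the basis contributes `2ℓ+1`, the right side the constant times
  -- the area `4π`.
  have hc : MvPolynomial.eval ![0, 0, 1] q * (4 * Real.pi) = 2 * ℓ + 1 := by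
    have h1 : ∫ x, ∑ k, Y k x * Y k x ∂surfaceMeasure = 2 * ℓ + 1 := by
      have hcont : ∀ k, Continuous (Y k) := fun k => (hY.harmonic k).continuous
      rw [integral_finsetSum _ fun k _ => integrable_of_continuous (by fun_prop)]
      simp [hY.orthonormal]
    simp only [hall, dotp_self, legendreP_eval_one, mul_one, integral_const, Measure.real,
      surfaceMeasure_univ] at h1
    rw [ENNReal.toReal_ofReal (by positivity), smul_eq_mul] at h1
    linarith
  rw [hall, eq_comm]
  congr 1
  rw [div_eq_iff (by positivity), hc]

end SphereKernel

namespace SphereKernel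

/-! ### Surface gradients -/

theorem radialExtension_of_ne_zero (f : S2 → ℝ) {z : E3} (h : z ≠ 0) :
    radialExtension f z = f ⟨‖z‖⁻¹ • z, by simp [norm_smul, h]⟩ := by
  rw [radialExtension, dif_neg h]

theorem coe_ne_zero (x : S2) : (x : E3) ≠ 0 := ne_zero_of_mem_unit_sphere x

theorem differentiableAt_eval_comp {σ E : Type*} [NormedAddCommGroup E] [NormedSpace ℝ E]
    (p : MvPolynomial σ ℝ) {u : E → σ → ℝ} {z : E}
    (hu : ∀ i, DifferentiableAt ℝ (fun z => u z i) z) :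
    DifferentiableAt ℝ (fun z => MvPolynomial.eval (u z) p) z := by
  induction p using MvPolynomial.induction_on with
  | C a => simp
  | add p q hp hq =>
    simp only [map_add]
    exact hp.add hq
  | mul_X p k hp =>
    simp only [map_mul, MvPolynomial.eval_X]
    exact hp.mul (hu k)

theorem IsSphericalHarmonic.differentiableAt_radialExtension {ℓ : ℕ} {f : S2 → ℝ}
    (hf : IsSphericalHarmonic ℓ f) (x : S2) :
    DifferentiableAt ℝ (radialExtension f) (x : E3) := by
  obtain ⟨p, -, -, hp⟩ := hf
  have h : DifferentiableAt ℝ (fun z : E3 => MvPolynomial.eval (‖z‖⁻¹ • z).ofLp p) (x : E3) := by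
    apply differentiableAt_eval_comp
    intro i
    have h1 : DifferentiableAt ℝ (fun z : E3 => ‖z‖⁻¹) (x : E3) :=
      ((contDiffAt_norm ℝ (coe_ne_zero x)).differentiableAt one_ne_zero).inv
        (norm_ne_zero_iff.2 (coe_ne_zero x))
    have h2 : DifferentiableAt ℝ (fun z : E3 => z.ofLp i) (x : E3) :=
      (EuclideanSpace.proj (𝕜 := ℝ) i).differentiableAt
    exact h1.mul h2
  refine h.congr_of_eventuallyEq ?_
  filter_upwards [isOpen_ne.mem_nhds (coe_ne_zero x)] with z hz
  rw [radialExtension_of_ne_zero f hz, hp]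
  rfl

theorem IsSphericalHarmonic.hasDerivAt_radialExtension {ℓ : ℕ} {f : S2 → ℝ}
    (hf : IsSphericalHarmonic ℓ f) (x : S2) (i : Fin 3) :
    HasDerivAt (fun τ : ℝ => radialExtension f ((x : E3) + τ • EuclideanSpace.single i 1))
      (surfaceGradient f x i) 0 := by
  have hd := hf.differentiableAt_radialExtension x
  have h := (hd.hasFDerivAt.hasLineDerivAt (EuclideanSpace.single i (1 : ℝ)))
  rw [HasLineDerivAt] at h
  refine h.congr_deriv ?_
  have h2 : inner ℝ (gradient (radialExtension f) (x : E3)) (EuclideanSpace.single i 1)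
      = fderiv ℝ (radialExtension f) (x : E3) (EuclideanSpace.single i 1) := by
    rw [gradient, InnerProductSpace.toDual_symm_apply]
  rw [← h2, EuclideanSpace.inner_single_right]
  simp [surfaceGradient]

/-! ### Differentiating the addition theorem in both variables. -/

theorem sum_radialExtension {ℓ : ℕ} {Y : Fin (2 * ℓ + 1) → S2 → ℝ}
    (hY : IsHarmonicOrthonormalBasis ℓ Y) {z w : E3} (hz : z ≠ 0) (hw : w ≠ 0) :
    ∑ k, radialExtension (Y k) z * radialExtension (Y k) w
      = (2 * ℓ + 1) / (4 * Real.pi) * (legendreP ℓ).eval (inner ℝ w z / ‖z‖ / ‖w‖) := by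
  simp only [radialExtension_of_ne_zero _ hz, radialExtension_of_ne_zero _ hw]
  rw [sum_harmonics_eq_legendreP hY]
  congr 2
  simp only [dotp, real_inner_smul_left, real_inner_smul_right]
  rw [real_inner_comm]
  ring

/-- Normalisation differentiates to the tangential projection, so the derivative is `u · (I -
yyᵀ)e`. -/
theorem hasDerivAt_inner_div_norm (u e : E3) (y : S2) :
    HasDerivAt (fun σ : ℝ => inner ℝ u ((y : E3) + σ • e) / ‖(y : E3) + σ • e‖)
      (inner ℝ u e - inner ℝ u (y : E3) * inner ℝ (y : E3) e) 0 := by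
  have hy : ‖(y : E3)‖ = 1 := by simp
  have hlin : HasDerivAt (fun σ : ℝ => (y : E3) + σ • e) e 0 := by
    simpa using ((hasDerivAt_id (0 : ℝ)).smul_const e).const_add (y : E3)
  have h1 : HasDerivAt (fun σ : ℝ => inner ℝ u ((y : E3) + σ • e)) (inner ℝ u e) 0 := by
    simpa using (hasDerivAt_const (0 : ℝ) u).inner ℝ hlin
  have h2 : HasDerivAt (fun σ : ℝ => ‖(y : E3) + σ • e‖) (inner ℝ (y : E3) e) 0 := by
    have h3 := (hlin.norm_sq).sqrt (by simp)
    simp only [Real.sqrt_sq (norm_nonneg _)] at h3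
    refine h3.congr_deriv ?_
    simp
  refine (h1.div h2 (by simp)).congr_deriv ?_
  simp [hy]

theorem eventually_add_smul_ne_zero (x : S2) (e : E3) :
    ∀ᶠ τ : ℝ in 𝓝 0, (x : E3) + τ • e ≠ 0 := by
  have hc : ContinuousAt (fun τ : ℝ => (x : E3) + τ • e) 0 := by fun_prop
  exact hc.eventually_ne (by simpa using coe_ne_zero x)

/-- The point `w` is kept off the sphere so that the identity can be differentiated again along a
line in the second variable. -/
theorem sum_surfaceGradient_mul_radialExtension {ℓ : ℕ} {Y : Fin (2 * ℓ + 1) → S2 → ℝ}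
    (hY : IsHarmonicOrthonormalBasis ℓ Y) (x : S2) (i : Fin 3) {w : E3} (hw : w ≠ 0) :
    ∑ k, surfaceGradient (Y k) x i * radialExtension (Y k) w
      = (2 * ℓ + 1) / (4 * Real.pi) * ((legendreP ℓ).derivative.eval (inner ℝ (x : E3) w / ‖w‖)
        * (inner ℝ (EuclideanSpace.single i (1 : ℝ)) w / ‖w‖
          - inner ℝ (x : E3) w / ‖w‖ * vec x i)) := by
  have hL : HasDerivAt (fun τ : ℝ => ∑ k,
      radialExtension (Y k) ((x : E3) + τ • EuclideanSpace.single i 1) * radialExtension (Y k) w)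
      (∑ k, surfaceGradient (Y k) x i * radialExtension (Y k) w) 0 :=
    HasDerivAt.fun_sum fun k _ => ((hY.harmonic k).hasDerivAt_radialExtension x i).mul_const _
  have hR := (((legendreP ℓ).hasDerivAt _).comp (0 : ℝ)
    ((hasDerivAt_inner_div_norm w (EuclideanSpace.single i 1) x).div_const ‖w‖)).const_mul
      ((2 * (ℓ : ℝ) + 1) / (4 * Real.pi))
  refine hL.unique ((hR.congr_deriv ?_).congr_of_eventuallyEq ?_)
  · have hx : ‖(x : E3)‖ = 1 := by simp
    simp only [zero_smul, add_zero, hx, div_one, real_inner_comm (x : E3) w,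
      real_inner_comm (EuclideanSpace.single i (1 : ℝ)) w]
    rw [EuclideanSpace.inner_single_right (𝕜 := ℝ) i 1 (x : E3)]
    simp only [vec, conj_trivial, one_mul]
    ring
  · filter_upwards [eventually_add_smul_ne_zero x (EuclideanSpace.single i 1)] with τ hτ
    exact sum_radialExtension hY hτ hw

theorem sum_surfaceGradient_mul_surfaceGradient {ℓ : ℕ} {Y : Fin (2 * ℓ + 1) → S2 → ℝ}
    (hY : IsHarmonicOrthonormalBasis ℓ Y) (x y : S2) (i j : Fin 3) :
    ∑ k, surfaceGradient (Y k) x i * surfaceGradient (Y k) y j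
      = (2 * ℓ + 1) / (4 * Real.pi) * ((legendreP ℓ).derivative.derivative.eval (dotp x y)
          * ((vec y i - dotp x y * vec x i) * (vec x j - dotp x y * vec y j))
        + (legendreP ℓ).derivative.eval (dotp x y)
          * ((if i = j then 1 else 0) - vec x i * vec x j - vec y i * vec y j
            + dotp x y * (vec x i * vec y j))) := by
  have hL : HasDerivAt (fun τ : ℝ => ∑ k, surfaceGradient (Y k) x i
      * radialExtension (Y k) ((y : E3) + τ • EuclideanSpace.single j 1))
      (∑ k, surfaceGradient (Y k) x i * surfaceGradient (Y k) y j) 0 :=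
    HasDerivAt.fun_sum fun k _ => ((hY.harmonic k).hasDerivAt_radialExtension y j).const_mul _
  have ha := hasDerivAt_inner_div_norm (x : E3) (EuclideanSpace.single j 1) y
  have hb := hasDerivAt_inner_div_norm (EuclideanSpace.single i 1) (EuclideanSpace.single j 1) y
  have hR := ((((legendreP ℓ).derivative.hasDerivAt _).comp (0 : ℝ) ha).mul
    (hb.sub (ha.mul_const (vec x i)))).const_mul ((2 * (ℓ : ℝ) + 1) / (4 * Real.pi))
  refine hL.unique ((hR.congr_deriv ?_).congr_of_eventuallyEq ?_)
  · have hy : ‖(y : E3)‖ = 1 := by simp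
    simp only [Function.comp, zero_smul, add_zero, hy, div_one, Pi.sub_apply]
    rw [EuclideanSpace.inner_single_right (𝕜 := ℝ) j 1 (x : E3),
      EuclideanSpace.inner_single_right (𝕜 := ℝ) j 1 (y : E3),
      EuclideanSpace.inner_single_left (𝕜 := ℝ) i 1 (y : E3),
      EuclideanSpace.inner_single_left (𝕜 := ℝ) i 1 (EuclideanSpace.single j 1)]
    simp only [vec, dotp, conj_trivial, one_mul, PiLp.single_apply]
    ring
  · filter_upwards [eventually_add_smul_ne_zero y (EuclideanSpace.single j 1)] with τ hτ
    exact sum_surfaceGradient_mul_radialExtension hY x i hτ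

/-! ### The terms of the expansions -/

theorem dotp_eq_sum (x y : S2) :
    dotp x y = vec x 0 * vec y 0 + vec x 1 * vec y 1 + vec x 2 * vec y 2 := by
  simp [dotp, vec, PiLp.inner_apply, Fin.sum_univ_three, mul_comm]

theorem matV_apply (x y : S2) (i j : Fin 3) :
    matV x y i j = (vec y i - dotp x y * vec x i) * (vec x j - dotp x y * vec y j) := by
  simp [matV, Matrix.vecMulVec_apply]

theorem matW_apply (x y : S2) (i j : Fin 3) :
    matW x y i j = (if i = j then 1 else 0) - vec x i * vec x j - vec y i * vec y j
      + dotp x y * (vec x i * vec y j) := by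
  rw [matW, mul_sub, sub_mul, sub_mul, Matrix.vecMulVec_mul_vecMulVec]
  simp only [mul_one, one_mul, Matrix.sub_apply, Matrix.one_apply, Matrix.vecMulVec_apply,
    Pi.smul_apply, smul_eq_mul]
  rw [show vec x ⬝ᵥ vec y = dotp x y by rw [dotp_eq_sum]; simp [dotProduct, Fin.sum_univ_three]]
  ring

variable {ψ : ℝ → ℝ} {Y : (ℓ : ℕ) → Fin (2 * ℓ + 1) → S2 → ℝ}

/-- At `ℓ = 0` both sides are `0` by the convention for inverses, so the term formulas need no case
split. -/
theorem inv_sqrt_mul_self (ℓ : ℕ) :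
    (√((ℓ : ℝ) * (ℓ + 1)))⁻¹ * (√((ℓ : ℝ) * (ℓ + 1)))⁻¹ = ((ℓ : ℝ) * (ℓ + 1))⁻¹ := by
  rw [← mul_inv, Real.mul_self_sqrt (by positivity)]

theorem kappaCoeff_eq (ℓ : ℕ) : kappaCoeff ψ ℓ = fourierLegendreCoeff ψ ℓ
    * (((ℓ : ℝ) * (ℓ + 1))⁻¹ * ((2 * ℓ + 1) / (4 * Real.pi))) := by
  rw [kappaCoeff, div_eq_mul_inv, div_eq_mul_inv, mul_inv, mul_inv]
  ring

theorem curlTerm_eq (hY : ∀ ℓ, IsHarmonicOrthonormalBasis ℓ (Y ℓ)) (ℓ : ℕ) (p : S2 × S2) :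
    curlTerm ψ Y ℓ p = kappaCoeff ψ ℓ •
      ((legendreP ℓ).derivative.derivative.eval (dotp p.1 p.2) • matV p.1 p.2
        + (legendreP ℓ).derivative.eval (dotp p.1 p.2) • matW p.1 p.2) := by
  ext i j
  simp only [curlTerm, curlHarmonic, Matrix.smul_apply, Matrix.sum_apply, Matrix.add_apply,
    Matrix.vecMulVec_apply, Pi.smul_apply, smul_eq_mul, matV_apply, matW_apply, kappaCoeff_eq]
  rw [mul_assoc, mul_assoc _ ((2 * (ℓ : ℝ) + 1) / _),
    ← sum_surfaceGradient_mul_surfaceGradient (hY ℓ) p.1 p.2 i j, ← inv_sqrt_mul_self,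
    Finset.mul_sum, Finset.mul_sum, Finset.mul_sum]
  exact Finset.sum_congr rfl fun k _ => by ring

/-- Every component of a cross product is a difference `α a_q - β a_q'`, so this passes from
gradients to curls. -/
theorem sum_sub_mul_sub {ι : Type*} [Fintype ι] {a b : ι → Fin 3 → ℝ} {S : Fin 3 → Fin 3 → ℝ}
    (h : ∀ i j, ∑ k, a k i * b k j = S i j) (q q' s s' : Fin 3) (α β γ δ : ℝ) :
    ∑ k, (α * a k q - β * a k q') * (γ * b k s - δ * b k s')
      = α * γ * S q s - α * δ * S q s' - β * γ * S q' s + β * δ * S q' s' := by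
  simp only [← h, Finset.mul_sum, ← Finset.sum_sub_distrib, ← Finset.sum_add_distrib]
  exact Finset.sum_congr rfl fun k _ => by ring

/-- Apply `x ×` on the left and `y ×` on the right of the gradient formula. The multiples of `x` and
`y` in the outer factors are annihilated, so `V` becomes `(x×y)(y×x)ᵀ = Q` and `W` becomes `R`. -/
theorem sum_surfaceCurl_mul_surfaceCurl {ℓ : ℕ} {Y : Fin (2 * ℓ + 1) → S2 → ℝ}
    (hY : IsHarmonicOrthonormalBasis ℓ Y) (x y : S2) (i j : Fin 3) :
    ∑ k, surfaceCurl (Y k) x i * surfaceCurl (Y k) y j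
      = (2 * ℓ + 1) / (4 * Real.pi) * ((legendreP ℓ).derivative.derivative.eval (dotp x y)
          * matQ x y i j + (legendreP ℓ).derivative.eval (dotp x y) * matR x y i j) := by
  have h := sum_sub_mul_sub (sum_surfaceGradient_mul_surfaceGradient hY x y)
  have ht := dotp_eq_sum x y
  generalize (legendreP ℓ).derivative.derivative.eval (dotp x y) = P₂ at *
  generalize (legendreP ℓ).derivative.eval (dotp x y) = P₁ at *
  simp only [surfaceCurl, matQ, matR, Matrix.sub_apply, Matrix.neg_apply, Matrix.smul_apply,
    Matrix.vecMulVec_apply, Matrix.one_apply, cross_apply, smul_eq_mul]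
  fin_cases i <;> fin_cases j <;> simp [h] <;> rw [ht] <;> ring

theorem divTerm_eq (hY : ∀ ℓ, IsHarmonicOrthonormalBasis ℓ (Y ℓ)) (ℓ : ℕ) (p : S2 × S2) :
    divTerm ψ Y ℓ p = kappaCoeff ψ ℓ •
      ((legendreP ℓ).derivative.derivative.eval (dotp p.1 p.2) • matQ p.1 p.2
        + (legendreP ℓ).derivative.eval (dotp p.1 p.2) • matR p.1 p.2) := by
  ext i j
  simp only [divTerm, divHarmonic, Matrix.smul_apply, Matrix.sum_apply, Matrix.add_apply,
    Matrix.vecMulVec_apply, Pi.smul_apply, smul_eq_mul, kappaCoeff_eq]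
  rw [mul_assoc, mul_assoc _ ((2 * (ℓ : ℝ) + 1) / _),
    ← sum_surfaceCurl_mul_surfaceCurl (hY ℓ) p.1 p.2 i j, ← inv_sqrt_mul_self, Finset.mul_sum, Finset.mul_sum,
    Finset.mul_sum]
  exact Finset.sum_congr rfl fun k _ => by ring

/-! ### Bounds and continuity -/

theorem dotp_mem_Icc (x y : S2) : dotp x y ∈ Set.Icc (-1 : ℝ) 1 := by
  have := abs_real_inner_le_norm (x : E3) (y : E3)
  simp only [norm_eq_of_mem_sphere, mul_one] at this
  exact abs_le.1 this

theorem dotp_mem_Ioo {x y : S2} (h : x ≠ y) (h' : x ≠ -y) : dotp x y ∈ Set.Ioo (-1 : ℝ) 1 := by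
  have hm := dotp_mem_Icc x y
  refine ⟨lt_of_le_of_ne hm.1 fun he => h' (Subtype.ext ?_),
    lt_of_le_of_ne hm.2 fun he => h (Subtype.ext ?_)⟩
  · refine (inner_eq_one_iff_of_norm_eq_one (𝕜 := ℝ) (by simp) (by simp)).1 ?_
    have : inner ℝ (x : E3) (y : E3) = -1 := he.symm
    simp [this]
  · exact (inner_eq_one_iff_of_norm_eq_one (𝕜 := ℝ) (by simp) (by simp)).1 he

theorem dotp_sq_eq_one {x y : S2} (h : x = y ∨ x = -y) : dotp x y ^ 2 = 1 := by
  rcases h with rfl | rfl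
  · rw [dotp_self, one_pow]
  · have : dotp (-y) y = -dotp y y := by simp [dotp]
    rw [this, dotp_self]
    norm_num

theorem abs_vec_le_one (x : S2) (i : Fin 3) : |vec x i| ≤ 1 := by
  rw [← sq_le_one_iff_abs_le_one, ← sum_vec_sq x]
  exact Finset.single_le_sum (f := fun i => vec x i ^ 2) (fun _ _ => sq_nonneg _)
    (Finset.mem_univ i)

theorem abs_mul_le_of_sum_sq {a b : Fin 3 → ℝ} {r : ℝ} (ha : ∑ i, a i ^ 2 = r)
    (hb : ∑ i, b i ^ 2 = r) (i j : Fin 3) : |a i * b j| ≤ r := by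
  have h1 : a i ^ 2 ≤ r := ha ▸ Finset.single_le_sum (f := fun i => a i ^ 2)
    (fun _ _ => sq_nonneg _) (Finset.mem_univ i)
  have h2 : b j ^ 2 ≤ r := hb ▸ Finset.single_le_sum (f := fun i => b i ^ 2)
    (fun _ _ => sq_nonneg _) (Finset.mem_univ j)
  rw [abs_le]
  constructor <;> nlinarith [sq_nonneg (a i + b j), sq_nonneg (a i - b j)]

/-- Pythagoras for the tangential part of `y` at `x`. The factor `1 - t²` is what offsets the growth
of `P_ℓ''`. -/
theorem sum_sq_sub_dotp_mul (x y : S2) :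
    ∑ i, (vec y i - dotp x y * vec x i) ^ 2 = 1 - dotp x y ^ 2 := by
  have hx := sum_vec_sq x
  have hy := sum_vec_sq y
  have ht := dotp_eq_sum x y
  rw [Fin.sum_univ_three] at *
  linear_combination hy + dotp x y ^ 2 * hx + 2 * dotp x y * ht

theorem abs_matV_apply_le (x y : S2) (i j : Fin 3) : |matV x y i j| ≤ 1 - dotp x y ^ 2 := by
  rw [matV_apply]
  have hc : dotp x y = dotp y x := real_inner_comm _ _
  refine abs_mul_le_of_sum_sq (a := fun i => vec y i - dotp x y * vec x i)
    (b := fun j => vec x j - dotp x y * vec y j) (sum_sq_sub_dotp_mul x y) ?_ i j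
  rw [hc]
  exact sum_sq_sub_dotp_mul y x

theorem abs_matQ_apply_le (x y : S2) (i j : Fin 3) : |matQ x y i j| ≤ 1 - dotp x y ^ 2 := by
  have h : ∑ i, ((vec x ⨯₃ vec y) i) ^ 2 = 1 - dotp x y ^ 2 := by
    have hx := sum_vec_sq x
    have hy := sum_vec_sq y
    rw [Fin.sum_univ_three] at *
    rw [dotp_eq_sum]
    simp [cross_apply]
    linear_combination hx * (vec y 0 ^ 2 + vec y 1 ^ 2 + vec y 2 ^ 2) + hy
  rw [matQ, Matrix.neg_apply, abs_neg, Matrix.vecMulVec_apply]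
  exact abs_mul_le_of_sum_sq h h i j

theorem abs_mul_le_one_of_abs_le_one {a b : ℝ} (ha : |a| ≤ 1) (hb : |b| ≤ 1) : |a * b| ≤ 1 := by
  rw [abs_mul]
  exact mul_le_one₀ ha (abs_nonneg _) hb

theorem abs_matW_apply_le (x y : S2) (i j : Fin 3) : |matW x y i j| ≤ 4 := by
  have h1 := abs_le.1 (abs_mul_le_one_of_abs_le_one (abs_vec_le_one x i) (abs_vec_le_one x j))
  have h2 := abs_le.1 (abs_mul_le_one_of_abs_le_one (abs_vec_le_one y i) (abs_vec_le_one y j))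
  have h3 := abs_le.1 (abs_mul_le_one_of_abs_le_one (abs_le.2 (dotp_mem_Icc x y))
    (abs_mul_le_one_of_abs_le_one (abs_vec_le_one x i) (abs_vec_le_one y j)))
  rw [matW_apply, abs_le]
  split_ifs <;> constructor <;> linarith

theorem abs_matR_apply_le (x y : S2) (i j : Fin 3) : |matR x y i j| ≤ 4 := by
  have h1 := abs_le.1 (abs_mul_le_one_of_abs_le_one (abs_vec_le_one y i) (abs_vec_le_one x j))
  have h2 := dotp_mem_Icc x y
  simp only [matR, Matrix.sub_apply, Matrix.smul_apply, Matrix.one_apply, Matrix.vecMulVec_apply,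
    smul_eq_mul]
  rw [abs_le]
  split_ifs <;> constructor <;> linarith [h2.1, h2.2]

theorem continuous_vec : Continuous vec :=
  (PiLp.continuous_ofLp 2 _).comp continuous_subtype_val

theorem continuous_dotp : Continuous fun p : S2 × S2 => dotp p.1 p.2 :=
  (continuous_subtype_val.comp continuous_fst).inner (continuous_subtype_val.comp continuous_snd)

theorem continuous_vec_apply_fst (i : Fin 3) : Continuous fun p : S2 × S2 => vec p.1 i :=
  (continuous_apply i).comp (continuous_vec.comp continuous_fst)

theorem continuous_vec_apply_snd (i : Fin 3) : Continuous fun p : S2 × S2 => vec p.2 i :=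
  (continuous_apply i).comp (continuous_vec.comp continuous_snd)

theorem continuous_matV : Continuous fun p : S2 × S2 => matV p.1 p.2 := by
  refine continuous_matrix fun i j => ?_
  simp only [matV_apply]
  have := continuous_dotp
  have := continuous_vec_apply_fst
  have := continuous_vec_apply_snd
  fun_prop

theorem continuous_matW : Continuous fun p : S2 × S2 => matW p.1 p.2 := by
  refine continuous_matrix fun i j => ?_
  simp only [matW_apply]
  have := continuous_dotp
  have := continuous_vec_apply_fst
  have := continuous_vec_apply_snd
  fun_prop

theorem continuous_matQ : Continuous fun p : S2 × S2 => matQ p.1 p.2 := by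
  have := continuous_vec_apply_fst
  have := continuous_vec_apply_snd
  have hc : ∀ i, Continuous fun p : S2 × S2 => (vec p.1 ⨯₃ vec p.2) i := by
    intro i
    simp only [cross_apply]
    fin_cases i <;> simp <;> fun_prop
  refine continuous_matrix fun i j => ?_
  simp only [matQ, Matrix.neg_apply, Matrix.vecMulVec_apply]
  exact ((hc i).mul (hc j)).neg

theorem continuous_matR : Continuous fun p : S2 × S2 => matR p.1 p.2 := by
  refine continuous_matrix fun i j => ?_
  simp only [matR, Matrix.sub_apply, Matrix.smul_apply, Matrix.vecMulVec_apply, smul_eq_mul]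
  have := continuous_dotp
  have := continuous_vec_apply_fst
  have := continuous_vec_apply_snd
  fun_prop

/-! ### Uniform convergence and identification of the sums. -/

/-- The spectral norm is controlled by the entries. -/
theorem norm_le_mul_of_abs_apply_le {M : Mat3} {r : ℝ} (h : ∀ i j, |M i j| ≤ r) :
    ‖M‖ ≤ (∑ i, ∑ j, ‖(Matrix.single i j 1 : Mat3)‖) * r := by
  conv_lhs => rw [Matrix.matrix_eq_sum_single M]
  rw [Finset.sum_mul]
  refine (norm_sum_le _ _).trans (Finset.sum_le_sum fun i _ => ?_)
  rw [Finset.sum_mul]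
  refine (norm_sum_le _ _).trans (Finset.sum_le_sum fun j _ => ?_)
  have : (Matrix.single i j (M i j) : Mat3) = M i j • Matrix.single i j 1 := by
    rw [Matrix.smul_single, smul_eq_mul, mul_one]
  rw [this, norm_smul, mul_comm]
  exact mul_le_mul_of_nonneg_left (h i j) (norm_nonneg _)

theorem sum_Icc_one_eq_sum_range {M : Type*} [AddCommMonoid M] (f : ℕ → M) (N : ℕ) :
    ∑ ℓ ∈ Finset.Icc 1 N, f ℓ = ∑ n ∈ Finset.range N, f (n + 1) := by
  rw [Finset.range_eq_Ico, Finset.sum_Ico_add' f 0 N 1]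
  rfl

/-- The Weierstrass test for series of matrix-valued functions. -/
theorem sumsAbsolutelyUniformlyTo_tsum {X : Type*} {u : ℕ → X → Mat3} {b : ℕ → ℝ}
    (hb : Summable b) (hu : ∀ n p, ‖u (n + 1) p‖ ≤ b n) :
    SumsAbsolutelyUniformlyTo u fun p => ∑' n, u (n + 1) p := by
  refine ⟨fun p => Summable.of_nonneg_of_le (fun _ => norm_nonneg _) (fun n => hu n p) hb, ?_, ?_⟩
  · simp only [sum_Icc_one_eq_sum_range]
    exact tendstoUniformly_tsum_nat hb fun n p => by simpa using hu n p
  · simp only [sum_Icc_one_eq_sum_range]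
    exact tendstoUniformly_tsum_nat hb fun n p => hu n p

/-- Summation of the series `∑ c_ℓ (P_ℓ''(t) A + P_ℓ'(t) B)`. -/
theorem exists_kernel_expansion (hψ : ContinuousOn ψ (Set.Icc (-1) 1))
    (hψ0 : fourierLegendreCoeff ψ 0 = 1)
    (hsum : Summable fun ℓ : ℕ => (ℓ : ℝ) * |fourierLegendreCoeff ψ ℓ|)
    {A B : S2 → S2 → Mat3} (hA : Continuous fun p : S2 × S2 => A p.1 p.2)
    (hB : Continuous fun p : S2 × S2 => B p.1 p.2)
    (hA' : ∀ x y i j, |A x y i j| ≤ 1 - dotp x y ^ 2) (hB' : ∀ x y i j, |B x y i j| ≤ 4)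
    {u : ℕ → S2 × S2 → Mat3}
    (hu : ∀ ℓ p, u ℓ p = kappaCoeff ψ ℓ •
      ((legendreP ℓ).derivative.derivative.eval (dotp p.1 p.2) • A p.1 p.2
        + (legendreP ℓ).derivative.eval (dotp p.1 p.2) • B p.1 p.2)) :
    ∃ Ψ : S2 × S2 → Mat3, Continuous Ψ ∧
      (∀ x y : S2, x ≠ y → x ≠ -y →
        Ψ (x, y) = deriv (kappa ψ) (dotp x y) • A x y + kappa ψ (dotp x y) • B x y) ∧
      (∀ x y : S2, x = y ∨ x = -y → Ψ (x, y) = kappa ψ (dotp x y) • B x y) ∧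
      SumsAbsolutelyUniformlyTo u Ψ := by
  set K := ∑ i, ∑ j, ‖(Matrix.single i j 1 : Mat3)‖
  -- The `4` is `2` from the bound on `(1-t²)P_ℓ''` plus `1/2 · 4` from the bounds on `P_ℓ'` and
  -- `B`.
  have hbound : ∀ ℓ p, ‖u ℓ p‖ ≤ K * (4 * ((ℓ * (ℓ + 1)) * |kappaCoeff ψ ℓ|)) := by
    intro ℓ p
    apply norm_le_mul_of_abs_apply_le
    intro i j
    rw [hu]
    simp only [Matrix.smul_apply, Matrix.add_apply, smul_eq_mul]
    have ht := dotp_mem_Icc p.1 p.2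
    set t := dotp p.1 p.2
    have h1 : |(legendreP ℓ).derivative.derivative.eval t * A p.1 p.2 i j|
        ≤ 2 * ((ℓ : ℝ) * ((ℓ : ℝ) + 1)) := by
      refine le_trans ?_ (abs_one_sub_sq_mul_derivative_two_legendreP_le ℓ ht)
      rw [abs_mul, abs_mul, mul_comm]
      exact mul_le_mul_of_nonneg_right ((hA' _ _ i j).trans (le_abs_self _)) (abs_nonneg _)
    have h2 : |(legendreP ℓ).derivative.eval t * B p.1 p.2 i j|
        ≤ (ℓ * (ℓ + 1) / 2) * 4 := by
      rw [abs_mul]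
      exact mul_le_mul (abs_derivative_legendreP_le ℓ ht) (hB' _ _ i j) (abs_nonneg _)
        (by positivity)
    rw [abs_mul]
    have h3 := abs_add_le ((legendreP ℓ).derivative.derivative.eval t * A p.1 p.2 i j)
      ((legendreP ℓ).derivative.eval t * B p.1 p.2 i j)
    calc _ ≤ |kappaCoeff ψ ℓ| * (4 * ((ℓ : ℝ) * ((ℓ : ℝ) + 1))) :=
          mul_le_mul_of_nonneg_left (by linarith) (abs_nonneg _)
      _ = _ := by ring
  have hb : Summable fun n : ℕ =>
      K * (4 * ((((n + 1 : ℕ) : ℝ) * ((n + 1 : ℕ) + 1)) * |kappaCoeff ψ (n + 1)|)) :=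
    ((summable_kappaCoeff hsum).mul_left 4).mul_left K
  -- The extension is the sum of the series, so only its values remain to be identified.
  refine ⟨fun p => ∑' n, u (n + 1) p, ?_, ?_, ?_,
    sumsAbsolutelyUniformlyTo_tsum hb fun n p => hbound (n + 1) p⟩
  · refine continuous_tsum (fun n => ?_) hb fun n p => hbound (n + 1) p
    rw [show u (n + 1) = _ from funext (hu (n + 1))]
    have hP : ∀ q : Polynomial ℝ, Continuous fun p : S2 × S2 => q.eval (dotp p.1 p.2) :=
      fun q => q.continuous.comp continuous_dotp
    exact (((hP _).smul hA).add ((hP _).smul hB)).const_smul (kappaCoeff ψ (n + 1))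
  · intro x y hxy hxy'
    have ht := dotp_mem_Ioo hxy hxy'
    have h1 := (hasSum_deriv_kappa hψ hψ0 hsum ht).smul_const (A x y)
    have h2 := (hasSum_kappaSeries hsum (dotp_mem_Icc x y)).smul_const (B x y)
    rw [← kappa_eq_kappaSeries hψ hψ0 hsum (dotp_mem_Icc x y)] at h2
    rw [← (h1.add h2).tsum_eq]
    refine tsum_congr fun n => ?_
    rw [hu, smul_add, smul_smul, smul_smul]
  · intro x y hxy
    -- At `x = ±y` the bound `1 - t²` is zero, so the terms with `P_ℓ''` drop out.
    have hA0 : A x y = 0 := by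
      ext i j
      have := hA' x y i j
      rw [dotp_sq_eq_one hxy, sub_self] at this
      exact abs_nonpos_iff.1 this
    have h2 := (hasSum_kappaSeries hsum (dotp_mem_Icc x y)).smul_const (B x y)
    rw [← kappa_eq_kappaSeries hψ hψ0 hsum (dotp_mem_Icc x y)] at h2
    rw [← h2.tsum_eq]
    refine tsum_congr fun n => ?_
    rw [hu, hA0, smul_zero, zero_add, smul_smul]

end SphereKernel

theorem mainTheorem1 (ψ : ℝ → ℝ)
    (Y : (ℓ : ℕ) → Fin (2 * ℓ + 1) → S2 → ℝ)
    (hY : ∀ ℓ, IsHarmonicOrthonormalBasis ℓ (Y ℓ))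
    (hψ : ContinuousOn ψ (Set.Icc (-1) 1))
    (hψ0 : fourierLegendreCoeff ψ 0 = 1)
    (hsum : Summable fun ℓ : ℕ => (ℓ : ℝ) * |fourierLegendreCoeff ψ ℓ|) :
    (∀ t ∈ Set.Ioo (-1 : ℝ) 1, kappa ψ t = kappaQuotient ψ t) ∧
    ContinuousOn (kappa ψ) (Set.Icc (-1) 1) ∧
    DifferentiableOn ℝ (kappa ψ) (Set.Ioo (-1) 1) ∧
    (∃ Ψdiv : S2 × S2 → Mat3, Continuous Ψdiv ∧
      (∀ x y : S2, x ≠ y → x ≠ -y → Ψdiv (x, y) = kernelDiv ψ x y) ∧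
      (∀ x y : S2, x = y ∨ x = -y → Ψdiv (x, y) = kappa ψ (dotp x y) • matR x y) ∧
      SumsAbsolutelyUniformlyTo (divTerm ψ Y) Ψdiv) ∧
    (∃ Ψcurl : S2 × S2 → Mat3, Continuous Ψcurl ∧
      (∀ x y : S2, x ≠ y → x ≠ -y → Ψcurl (x, y) = kernelCurl ψ x y) ∧
      (∀ x y : S2, x = y ∨ x = -y → Ψcurl (x, y) = kappa ψ (dotp x y) • matW x y) ∧
      SumsAbsolutelyUniformlyTo (curlTerm ψ Y) Ψcurl) :=
  ⟨fun _ ht => kappa_eq_kappaQuotient hψ hψ0 hsum ht,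
    (continuousOn_kappaSeries hsum).congr fun _ ht => kappa_eq_kappaSeries hψ hψ0 hsum ht,
    differentiableOn_kappa hψ hψ0 hsum,
    exists_kernel_expansion hψ hψ0 hsum continuous_matQ continuous_matR abs_matQ_apply_le
      abs_matR_apply_le (divTerm_eq hY),
    exists_kernel_expansion hψ hψ0 hsum continuous_matV continuous_matW abs_matV_apply_le
      abs_matW_apply_le (curlTerm_eq hY)⟩
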